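/- Let $(A,\mathfrak m)$ be a complete Cohen–Macaulay Noetherian local ring of dimension $d$ with infinite residue field $k$, and let $E$ be the injective hull of $k$; write $D^\vee=\operatorname{Hom}_A(D,E)$ for an $A$-module $D$. Let $N$ be a perfect $A$-module (that is, $N$ is finitely generated and nonzero, and its projective dimension equals its grade $\inf\{i : \operatorname{Ext}^i_A(N,A)\neq 0\}$), let $I\subseteq\mathfrak m$ be an ideal such that $\ell(N/IN)$ is finite, and let $M$ be a finitely generated $A$-module. Let $\mathcal R(I)=\bigoplus_{i\ge 0}I^it^i$ be the Rees algebra of $I$ and put $$V(M)=\bigoplus_{n\ge 0}V(M)_n,\qquad V(M)_n=\operatorname{Ext}^{d+1}_A(N/I^{n+1}N,M)^\vee ,$$ where, for $a\in I^i$, the element $at^i\in\mathcal R(I)$ acts as the map $V(M)_n\to V(M)_{n+i}$ that is dual to the map $\operatorname{Ext}^{d+1}_A(N/I^{n+i+1}N,M)\to\operatorname{Ext}^{d+1}_A(N/I^{n+1}N,M)$ induced by multiplication by $a$, $N/I^{n+1}N\to N/I^{n+i+1}N$. Then $V(M)$ is a finitely generated graded $\mathcal R(I)$-module. Consequently, for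 all $n\ge 0$ the length $\ell(\operatorname{Ext}^{d+1}_A(N/I^{n+1}N,M))=\ell(V(M)_n)$ is finite, and there is a polynomial $P\in\mathbb Q[X]$ of degree at most $\dim N-1$ (the zero polynomial having degree $-1$) such that $\ell(\operatorname{Ext}^{d+1}_A(N/I^{n+1}N,M))=P(n)$ for all $n\gg 0$. -/

import Mathlib

universe u

open CategoryTheory

noncomputable section

namespace ReesExt

variable {A : Type u} [CommRing A]

/-- A local ring is Cohen-Macaulay if its maximal ideal contains a regular sequence whose length
is the Krull dimension of the ring (meant for Noetherian rings). -/
def IsCohenMacaulayLocal (A : Type u) [CommRing A] [IsLocalRing A] : Prop :=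
  ∃ rs : List A, RingTheory.Sequence.IsRegular A rs ∧
    (∀ x ∈ rs, x ∈ IsLocalRing.maximalIdeal A) ∧ (rs.length : WithBot ℕ∞) = ringKrullDim A

/-- The grade of a module `N`: the infimum of all `i` with `Ext^i_A(N, A) ≠ 0`
(`⊤` if there is no such `i`). -/
def grade (A : Type u) [CommRing A] (N : Type u) [AddCommGroup N] [Module A N] : ℕ∞ :=
  ⨅ (i : ℕ) (_ : Nontrivial (Abelian.Ext (ModuleCat.of A N) (ModuleCat.of A A) i)), (i : ℕ∞)

/-- A perfect module: finitely generated, nonzero, with projective dimension equal to its grade. -/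
structure IsPerfect (A : Type u) [CommRing A] (N : Type u) [AddCommGroup N] [Module A N] :
    Prop where
  finite : Module.Finite A N
  nontrivial : Nontrivial N
  projectiveDimension_eq :
    projectiveDimension (ModuleCat.of A N) = ((grade A N : ℕ∞) : WithBot ℕ∞)

/-- `E` is an injective hull of the residue field of `A`: it is injective, and it is an essential
extension of (the image of) the residue field. -/
structure IsResidueFieldInjectiveHull (A : Type u) [CommRing A] [IsLocalRing A]
    (E : Type u) [AddCommGroup E] [Module A E] : Prop where
  injective : Module.Injective A E
  exists_essential : ∃ ι : IsLocalRing.ResidueField A →ₗ[A] E, Function.Injective ι ∧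
    ∀ S : Submodule A E, S ≠ ⊥ → S ⊓ LinearMap.range ι ≠ ⊥

/-- The degree of a polynomial, where the zero polynomial has degree `-1`. -/
def polyDeg (P : Polynomial ℚ) : ℤ := if P = 0 then -1 else (P.natDegree : ℤ)

/-- `f` has only finite values and agrees, for all large `n`, with a polynomial of degree at most
`b`, where the zero polynomial has degree `-1`. -/
def IsPolynomialTypeOfDegLE (f : ℕ → ℕ∞) (b : ℤ) : Prop :=
  (∀ n, f n ≠ ⊤) ∧ ∃ P : Polynomial ℚ, polyDeg P ≤ b ∧
    ∀ᶠ n : ℕ in Filter.atTop, ((f n).toNat : ℚ) = P.eval (n : ℚ)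

section Construction

variable (I : Ideal A) (N M E : Type u) [AddCommGroup N] [Module A N] [AddCommGroup M] [Module A M]
  [AddCommGroup E] [Module A E] (j : ℕ)

/-- `N / I^(n+1) N`. -/
abbrev FiltQuot (n : ℕ) : Type u := N ⧸ (I ^ (n + 1) • (⊤ : Submodule A N))

/-- Multiplication by `a ∈ I^i`, as a map `N / I^(m+1) N → N / I^(n+1) N` with `n = m + i`. -/
def mulQuot {i m n : ℕ} (h : n = m + i) (a : ↥(I ^ i)) : FiltQuot I N m →ₗ[A] FiltQuot I N n :=
  Submodule.mapQ _ _ (LinearMap.lsmul A N (a : A)) (by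
    subst h
    rw [Submodule.smul_le]
    intro r hr x _
    rw [Submodule.mem_comap, LinearMap.lsmul_apply, smul_smul]
    refine Submodule.smul_mem_smul ?_ Submodule.mem_top
    rw [show m + i + 1 = i + (m + 1) by omega, pow_add]
    exact Ideal.mul_mem_mul a.2 hr)

/-- `Ext^j_A(N / I^(n+1) N, M)`. -/
abbrev ExtPart (n : ℕ) : Type u :=
  Abelian.Ext (ModuleCat.of A (FiltQuot I N n)) (ModuleCat.of A M) j

/-- The dual `Ext^j_A(N / I^(n+1) N, M)^∨ = Hom_A(Ext^j_A(N / I^(n+1) N, M), E)`. -/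
abbrev DualPart (n : ℕ) : Type u := ExtPart I N M j n →ₗ[A] E

variable {N} in
/-- The map `Ext^j_A(N₂, M) → Ext^j_A(N₁, M)` induced by `f : N₁ → N₂`. -/
def extMap {N₁ N₂ : Type u} [AddCommGroup N₁] [Module A N₁] [AddCommGroup N₂] [Module A N₂]
    (f : N₁ →ₗ[A] N₂) :
    Abelian.Ext (ModuleCat.of A N₂) (ModuleCat.of A M) j →ₗ[A]
      Abelian.Ext (ModuleCat.of A N₁) (ModuleCat.of A M) j :=
  Abelian.Ext.bilinearCompOfLinear A _ _ _ 0 j j (zero_add j)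
    (Abelian.Ext.mk₀ (ModuleCat.ofHom f))

/-- The action of `a t^i`, `a ∈ I^i`, from the component of degree `m` to the one of degree
`n = m + i`: the dual of the map on `Ext` induced by multiplication by `a`. -/
def act {i m n : ℕ} (h : n = m + i) (a : ↥(I ^ i)) :
    DualPart I N M E j m →ₗ[A] DualPart I N M E j n :=
  LinearMap.lcomp A E (extMap M j (mulQuot I N h a))

/-- `V(M) = ⨁ₙ Ext^j_A(N / I^(n+1) N, M)^∨`. -/
def DualSum : Type u := DirectSum ℕ (DualPart I N M E j)

instance : AddCommGroup (DualSum I N M E j) :=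
  inferInstanceAs (AddCommGroup (DirectSum ℕ (DualPart I N M E j)))

instance : Module A (DualSum I N M E j) :=
  inferInstanceAs (Module A (DirectSum ℕ (DualPart I N M E j)))

/-- The inclusion of the component of degree `n`. -/
def incl (n : ℕ) : DualPart I N M E j n →ₗ[A] DualSum I N M E j :=
  DirectSum.lof A ℕ (DualPart I N M E j) n

/-- The action of `a t^i`, `a ∈ I^i`, on `V(M)`. -/
def actSum (i : ℕ) (a : ↥(I ^ i)) : Module.End A (DualSum I N M E j) :=
  DirectSum.toModule A ℕ (DualSum I N M E j) fun m => incl I N M E j (m + i) ∘ₗ act I N M E j rfl a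

variable {I N M E j}

theorem actSum_incl {i m : ℕ} (a : ↥(I ^ i)) (v : DualPart I N M E j m) :
    actSum I N M E j i a (incl I N M E j m v) = incl I N M E j (m + i) (act I N M E j rfl a v) :=
  DirectSum.toModule_lof A m v

theorem hom_ext {F G : Module.End A (DualSum I N M E j)}
    (h : ∀ m v, F (incl I N M E j m v) = G (incl I N M E j m v)) : F = G :=
  DirectSum.linearMap_ext A fun m => LinearMap.ext fun v => h m v

theorem extMap_add {N₁ N₂ : Type u} [AddCommGroup N₁] [Module A N₁] [AddCommGroup N₂] [Module A N₂]
    (f g : N₁ →ₗ[A] N₂) : extMap M j (f + g) = extMap M j f + extMap M j g := by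
  rw [extMap, ModuleCat.ofHom_add, Abelian.Ext.mk₀_add, map_add]; rfl

theorem extMap_comp {N₁ N₂ N₃ : Type u} [AddCommGroup N₁] [Module A N₁] [AddCommGroup N₂]
    [Module A N₂] [AddCommGroup N₃] [Module A N₃]
    (g : N₂ →ₗ[A] N₃) (f : N₁ →ₗ[A] N₂) : extMap M j (g ∘ₗ f) = extMap M j f ∘ₗ extMap M j g := by
  ext x
  simp [extMap, ModuleCat.ofHom_comp]

theorem extMap_id {N₁ : Type u} [AddCommGroup N₁] [Module A N₁] :
    extMap M j (LinearMap.id : N₁ →ₗ[A] N₁) = LinearMap.id := by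
  ext x
  simp [extMap, ModuleCat.ofHom_id]

theorem act_add {i m n : ℕ} (h : n = m + i) (a b : ↥(I ^ i)) :
    act I N M E j h (a + b) = act I N M E j h a + act I N M E j h b := by
  have : mulQuot I N h (a + b) = mulQuot I N h a + mulQuot I N h b := by
    refine Submodule.linearMap_qext _ (LinearMap.ext fun x => ?_)
    simp [mulQuot]
  ext v x
  simp [act, this, extMap_add]

theorem act_act {i k m n p : ℕ} (h : n = m + i) (h' : p = n + k) (h'' : p = m + (k + i))
    (a : ↥(I ^ i)) (b : ↥(I ^ k)) (c : ↥(I ^ (k + i))) (hc : (c : A) = b * a)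
    (v : DualPart I N M E j m) :
    act I N M E j h' b (act I N M E j h a v) = act I N M E j h'' c v := by
  have : mulQuot I N h'' c = mulQuot I N h' b ∘ₗ mulQuot I N h a := by
    refine Submodule.linearMap_qext _ (LinearMap.ext fun x => ?_)
    simp [mulQuot, hc, mul_smul, smul_comm (a : A) (b : A)]
  ext x
  simp [act, this, extMap_comp]

theorem act_one {m : ℕ} (a : ↥(I ^ 0)) (ha : (a : A) = 1) (v : DualPart I N M E j m) :
    act I N M E j (add_zero m).symm a v = v := by
  have : mulQuot I N (add_zero m).symm a = LinearMap.id := by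
    refine Submodule.linearMap_qext _ (LinearMap.ext fun x => ?_)
    simp [mulQuot, ha]
  ext x
  simp [act, this, extMap_id]

theorem incl_act_congr {i m n : ℕ} (h : n = m + i) (a : ↥(I ^ i)) (v : DualPart I N M E j m) :
    incl I N M E j (m + i) (act I N M E j rfl a v) = incl I N M E j n (act I N M E j h a v) := by
  subst h; rfl

theorem actSum_add (i : ℕ) (a b : ↥(I ^ i)) :
    actSum I N M E j i (a + b) = actSum I N M E j i a + actSum I N M E j i b := by
  refine hom_ext fun m v => ?_
  simp [actSum_incl, act_add]

variable (N M E j) in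
/-- `actSum` as an additive map. -/
def actHom (i : ℕ) : ↥(I ^ i) →+ Module.End A (DualSum I N M E j) :=
  AddMonoidHom.mk' (actSum I N M E j i) (actSum_add i)

theorem actHom_incl {i m : ℕ} (a : ↥(I ^ i)) (v : DualPart I N M E j m) :
    actHom N M E j i a (incl I N M E j m v) =
      incl I N M E j (m + i) (act I N M E j rfl a v) :=
  actSum_incl a v

theorem actHom_mul {i k : ℕ} (a : ↥(I ^ i)) (b : ↥(I ^ k)) (c : ↥(I ^ (k + i)))
    (hc : (c : A) = b * a) :
    actHom N M E j (k + i) c = actHom N M E j k b * actHom N M E j i a := by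
  refine hom_ext fun m v => ?_
  rw [Module.End.mul_apply, actHom_incl, actHom_incl, actHom_incl,
    act_act rfl rfl (by omega) a b c hc, incl_act_congr]

theorem actHom_one (a : ↥(I ^ 0)) (ha : (a : A) = 1) : actHom N M E j 0 a = 1 := by
  refine hom_ext fun m v => ?_
  rw [actHom_incl, incl_act_congr (add_zero m).symm, act_one a ha]; rfl

/-- The coefficient of `t^i` of an element of the Rees algebra, as an element of `I^i`. -/
def coeffHom (I : Ideal A) (i : ℕ) : reesAlgebra I →+ ↥(I ^ i) where
  toFun f := ⟨(f : Polynomial A).coeff i, f.2 i⟩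
  map_zero' := by ext; simp
  map_add' f g := by ext; simp

variable (I N M E j) in
/-- The action of the Rees algebra on `V(M)`: `f = ∑ aᵢ tⁱ` acts as the sum of the actions of
the `aᵢ tⁱ`. -/
def reesActFun (f : reesAlgebra I) : Module.End A (DualSum I N M E j) :=
  ∑ i ∈ (f : Polynomial A).support, actHom N M E j i (coeffHom I i f)

theorem reesActFun_eq (f : reesAlgebra I) (s : Finset ℕ)
    (hs : (f : Polynomial A).support ⊆ s) :
    reesActFun I N M E j f = ∑ i ∈ s, actHom N M E j i (coeffHom I i f) := by
  refine Finset.sum_subset hs fun i _ hi => ?_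
  have : coeffHom I i f = 0 := by
    ext
    simpa [coeffHom] using hi
  rw [this, map_zero]

theorem reesActFun_add (f g : reesAlgebra I) :
    reesActFun I N M E j (f + g) = reesActFun I N M E j f + reesActFun I N M E j g := by
  classical
  rw [reesActFun_eq (f + g) (f.1.support ∪ g.1.support) Polynomial.support_add,
    reesActFun_eq f _ Finset.subset_union_left, reesActFun_eq g _ Finset.subset_union_right,
    ← Finset.sum_add_distrib]
  simp only [map_add]

variable (I N M E j) in
/-- `reesActFun` as an additive map. -/
def reesActHom : reesAlgebra I →+ Module.End A (DualSum I N M E j) :=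
  AddMonoidHom.mk' (reesActFun I N M E j) reesActFun_add

/-- The element `a t^i` of the Rees algebra, for `a ∈ I^i`. -/
def reesMonomial (I : Ideal A) (i : ℕ) (a : ↥(I ^ i)) : reesAlgebra I :=
  ⟨Polynomial.monomial i (a : A), reesAlgebra.monomial_mem.2 a.2⟩

theorem reesActHom_monomial (i : ℕ) (a : ↥(I ^ i)) :
    reesActHom I N M E j (reesMonomial I i a) = actHom N M E j i a := by
  change reesActFun I N M E j _ = _
  rw [reesActFun_eq _ {i} (Polynomial.support_monomial_subset i (a : A)), Finset.sum_singleton]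
  congr 1
  ext
  simp [coeffHom, reesMonomial]

theorem sum_reesMonomial (f : reesAlgebra I) :
    f = ∑ i ∈ (f : Polynomial A).support, reesMonomial I i (coeffHom I i f) := by
  ext1
  rw [AddSubmonoidClass.coe_finsetSum]
  exact Polynomial.as_sum_support _

theorem reesActHom_mul (f g : reesAlgebra I) :
    reesActHom I N M E j (f * g) = reesActHom I N M E j f * reesActHom I N M E j g := by
  rw [sum_reesMonomial f, sum_reesMonomial g, Finset.sum_mul_sum]
  simp only [map_sum]
  rw [Finset.sum_mul_sum]
  refine Finset.sum_congr rfl fun k _ => Finset.sum_congr rfl fun i _ => ?_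
  generalize coeffHom I k f = b
  generalize coeffHom I i g = a
  have hm : (b : A) * a ∈ I ^ (k + i) := by
    rw [pow_add]
    exact Ideal.mul_mem_mul b.2 a.2
  have : reesMonomial I k b * reesMonomial I i a = reesMonomial I (k + i) ⟨_, hm⟩ := by
    ext1
    exact Polynomial.monomial_mul_monomial k i (b : A) a
  rw [this, reesActHom_monomial, reesActHom_monomial, reesActHom_monomial]
  exact actHom_mul a b _ rfl

theorem reesActHom_one : reesActHom I N M E j 1 = 1 := by
  have : (1 : reesAlgebra I) = reesMonomial I 0 ⟨1, by simp⟩ := by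
    ext1
    exact Polynomial.monomial_zero_one.symm
  rw [this, reesActHom_monomial]
  exact actHom_one _ rfl

variable (I N M E j) in
/-- The action of the Rees algebra on `V(M)` as a ring homomorphism. -/
def reesAct : reesAlgebra I →+* Module.End A (DualSum I N M E j) where
  toFun := reesActHom I N M E j
  map_one' := reesActHom_one
  map_mul' := reesActHom_mul
  map_zero' := map_zero _
  map_add' := map_add _

/-- `V(M)` as a module over the Rees algebra. -/
instance : Module (reesAlgebra I) (DualSum I N M E j) :=
  Module.compHom _ (reesAct I N M E j)

/-- How `a t^i` acts on the component of degree `n`. -/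
theorem reesMonomial_smul_incl {i n : ℕ} (a : ↥(I ^ i)) (v : DualPart I N M E j n) :
    reesMonomial I i a • incl I N M E j n v = incl I N M E j (n + i) (act I N M E j rfl a v) := by
  change reesActHom I N M E j _ _ = _
  rw [reesActHom_monomial]
  exact actSum_incl a v

end Construction

end ReesExt

end

noncomputable section

namespace ReesExt

open Abelian

variable {A : Type u} [CommRing A]

/-! Building an injective resolution of `M` from injective hulls gives a d-th cosyzygy C with
Ext^{i+1+d}(X, M) ≅ Ext^{i+1}(X, C) for all X and with Hom(k, C) finite. Let K be the submodule of C
of elements killed by a power of the maximal ideal 𝔪.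

The heart is `exists_torsion_module_hom_ext_surjective`: for U = I^{n+1}N the map Hom(U, K) →
Ext^{d+1}(N/U, M) is onto. Since N is perfect, ann N contains a regular sequence of length pd N, and
since A is Cohen–Macaulay this extends to a regular sequence of length d. Quotients of A by powers
of its entries have projective dimension d, so their Ext¹ into C vanishes. This makes the sequence
coregular on K, and coregularity embeds Ext¹(N, K) successively into Ext^{1 + pd N}(N, -) = 0
(`subsingleton_ext_of_isCoregular`). With Ext¹(N, K) = 0, an extension class of N/U by C can be
represented by a map U → K (`exists_hom_extClass_eq`).

Dually, V(M)_n embeds in Hom(U, K)^∨, which is a quotient of U ⊗ K^∨ because E is injective and U is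
finite. As A is complete and K is 𝔪-torsion with finite socle, K^∨ is finite (`finite_dual`). So
V(M) is a subquotient of a finite free module over the Noetherian Rees algebra (`finite_dualSum`).

Duality preserves finite lengths, and Hilbert–Serre makes them eventually polynomial. The degree is
bounded by counting: if v ∈ V(M)_m and k > m, then I^i v has length at most L(i+k) - L(i), where
L(n) = ℓ(A/(ann N + I^n)) = O(n^{dim N}). Summing over degrees telescopes, so the summed lengths are
also O(n^{dim N}). -/

/-! ### Injective hulls and cosyzygies. -/

theorem exists_maximal_disjoint {P : Type*} [AddCommGroup P] [Module A P] (p q : Submodule A P)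
    (h : Disjoint p q) :
    ∃ T : Submodule A P, p ≤ T ∧ Disjoint T q ∧ ∀ T', T ≤ T' → Disjoint T' q → T' = T := by
  obtain ⟨T, hpT, hT⟩ := zorn_le_nonempty₀ {T : Submodule A P | Disjoint T q}
    (fun c hc hcc y hy => ⟨sSup c, by
      rw [Set.mem_ofPred_eq, DirectedOn.disjoint_sSup_left hcc.directedOn]
      exact fun b hb => hc hb, fun z hz => le_sSup hz⟩) p h
  exact ⟨T, hpT, hT.prop, fun T' h1 h2 => (hT.eq_of_le h2 h1).symm⟩

/-- Every submodule of an injective module has an injective essential extension inside it. -/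
theorem exists_essential_extension (J : Type u) [AddCommGroup J] [Module A J]
    [hJ : Module.Injective A J] (C : Submodule A J) :
    ∃ T : Submodule A J, C ≤ T ∧ Module.Injective A T ∧
      ∀ S : Submodule A J, S ≤ T → S ⊓ C = ⊥ → S = ⊥ := by
  obtain ⟨T, -, hT, hTmax⟩ := exists_maximal_disjoint (⊥ : Submodule A J) C disjoint_bot_left
  obtain ⟨T', hCT', hT', hTmax'⟩ := exists_maximal_disjoint C T hT.symm
  have key : ∀ W : Submodule A J, T ≤ W → Disjoint W T' → W = T := fun W h1 h2 =>
    hTmax W h1 (h2.mono_right hCT')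
  have hinj : Function.Injective (T.mkQ ∘ₗ T'.subtype) := by
    rw [← LinearMap.ker_eq_bot, LinearMap.ker_comp, Submodule.ker_mkQ]
    rw [Submodule.eq_bot_iff]
    rintro ⟨x, hx⟩ hx2
    have := (Submodule.disjoint_def.1 hT') x hx hx2
    simpa using this
  obtain ⟨θ, hθ⟩ := Module.Injective.extension_property A (M := J) _ _
    (T.mkQ ∘ₗ T'.subtype) hinj T'.subtype
  have hθ' : ∀ x ∈ T', θ (T.mkQ x) = x := fun x hx => LinearMap.congr_fun hθ ⟨x, hx⟩
  -- `θ ∘ T.mkQ` is the identity on `T'`. Its preimage of `T` contains `T` and misses `T'`, so it is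
  -- `T` by maximality; hence `range θ` meets `T` trivially, and maximality of `T'` identifies it.
  -- Thus `T'` is a retract of `J`, which gives injectivity.
  have hr : LinearMap.range θ = T' := by
    refine hTmax' _ (fun x hx => ⟨_, hθ' x hx⟩) ?_
    rw [Submodule.disjoint_def]
    rintro _ ⟨z, rfl⟩ hz
    obtain ⟨y, rfl⟩ := T.mkQ_surjective z
    have : Submodule.comap (θ ∘ₗ T.mkQ) T = T := by
      refine key _ (fun x hx => ?_) ?_
      · rw [Submodule.mem_comap, LinearMap.comp_apply, Submodule.mkQ_apply,
          (Submodule.Quotient.mk_eq_zero T).2 hx, map_zero]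
        exact zero_mem _
      · rw [Submodule.disjoint_def]
        intro x hx hx'
        rw [Submodule.mem_comap, LinearMap.comp_apply, hθ' x hx'] at hx
        exact Submodule.disjoint_def.1 hT' x hx' hx
    have hy : y ∈ T := by
      rw [← this]; exact hz
    rw [Submodule.mkQ_apply, (Submodule.Quotient.mk_eq_zero T).2 hy, map_zero]
  refine ⟨T', hCT', ⟨fun X Y _ _ _ _ f hf g => ?_⟩, fun S hS hSC => ?_⟩
  · obtain ⟨g', hg'⟩ := hJ.out f hf (T'.subtype ∘ₗ g)
    refine ⟨LinearMap.codRestrict T' (θ ∘ₗ T.mkQ ∘ₗ g') (fun y => ?_), fun x => ?_⟩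
    · rw [← hr]; exact ⟨_, rfl⟩
    · ext
      simp only [LinearMap.codRestrict_apply, LinearMap.comp_apply, hg']
      exact hθ' _ (g x).2
  -- If `S ≤ T'` misses `C`, then `T ⊔ S` still misses `C`, so `S` is absorbed by `T` and lies in `T
  -- ⊓ T' = ⊥`.
  · have h1 : T ⊔ S = T := by
      refine hTmax _ le_sup_left ?_
      rw [Submodule.disjoint_def]
      intro c hc hcC
      obtain ⟨t, ht, s, hs, rfl⟩ := Submodule.mem_sup.1 hc
      have ht' : t ∈ T' := by
        simpa using T'.sub_mem (hCT' hcC) (hS hs)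
      have ht0 : t = 0 := Submodule.disjoint_def.1 hT' t ht' ht
      subst ht0
      rw [zero_add] at hcC ⊢
      have : s ∈ S ⊓ C := ⟨hs, hcC⟩
      rwa [hSC] at this
    rw [Submodule.eq_bot_iff]
    intro s hs
    exact Submodule.disjoint_def.1 hT' s (hS hs) (h1 ▸ Submodule.mem_sup_right hs)

theorem exists_injective_hull (C : Type u) [AddCommGroup C] [Module A C] :
    ∃ (J : Type u) (_ : AddCommGroup J) (_ : Module A J) (ι : C →ₗ[A] J),
      Module.Injective A J ∧ Function.Injective ι ∧
        ∀ S : Submodule A J, S ⊓ LinearMap.range ι = ⊥ → S = ⊥ := by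
  let J := Injective.under (ModuleCat.of A C)
  let ι : C →ₗ[A] J := (Injective.ι (ModuleCat.of A C)).hom
  have hι : Function.Injective ι := (ModuleCat.mono_iff_injective _).1 inferInstance
  have : Module.Injective A J := by
    have : Injective (ModuleCat.of A J) := inferInstanceAs (Injective J)
    exact Module.injective_module_of_injective_object A J
  obtain ⟨T, hT, hTinj, hess⟩ := exists_essential_extension J (LinearMap.range ι)
  refine ⟨T, inferInstance, inferInstance, LinearMap.codRestrict T ι fun x => hT ⟨x, rfl⟩, hTinj,
    fun x y h => hι (congrArg Subtype.val h), fun S hS => ?_⟩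
  have : S.map T.subtype = ⊥ := by
    refine hess _ (Submodule.map_subtype_le _ _) ?_
    rw [Submodule.eq_bot_iff]
    rintro _ ⟨⟨x, hx, rfl⟩, ⟨c, hc⟩⟩
    have : x ∈ S ⊓ LinearMap.range (LinearMap.codRestrict T ι fun x => hT ⟨x, rfl⟩) :=
      ⟨hx, c, Subtype.ext hc⟩
    rw [hS] at this
    rw [(Submodule.mem_bot A).1 this, map_zero]
  exact (Submodule.map_injective_of_injective T.injective_subtype) (by rw [this, Submodule.map_bot])

theorem finite_of_exact [IsNoetherianRing A] {X Y Z : Type*} [AddCommGroup X] [Module A X]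
    [AddCommGroup Y] [Module A Y] [AddCommGroup Z] [Module A Z] [Module.Finite A X]
    [Module.Finite A Z] (f : X →ₗ[A] Y) (g : Y →ₗ[A] Z)
    (h : ∀ y, g y = 0 → ∃ x, f x = y) : Module.Finite A Y := by
  have : Module.Finite A (LinearMap.ker g) := by
    have hle : LinearMap.ker g ≤ LinearMap.range f := fun y hy => h y hy
    have h2 : Module.Finite A (LinearMap.range f) := inferInstance
    have := isNoetherian_of_isNoetherianRing_of_finite A (LinearMap.range f)
    exact Module.Finite.of_injective (Submodule.inclusion hle) (Submodule.inclusion_injective _)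
  have h3 : Module.Finite A (Y ⧸ LinearMap.ker g) :=
    Module.Finite.equiv g.quotKerEquivRange.symm
  exact Module.Finite.of_submodule_quotient (LinearMap.ker g)

/-- The short complex of an exact pair of linear maps. -/
abbrev exactSC {X Y Z : Type u} [AddCommGroup X] [Module A X]
    [AddCommGroup Y] [Module A Y] [AddCommGroup Z] [Module A Z] {f : X →ₗ[A] Y} {g : Y →ₗ[A] Z}
    (h : Function.Exact f g) : ShortComplex (ModuleCat.{u} A) :=
  ModuleCat.shortComplexOfCompEqZero f g h.linearMap_comp_eq_zero

theorem exactSC_shortExact {X Y Z : Type u} [AddCommGroup X] [Module A X]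
    [AddCommGroup Y] [Module A Y] [AddCommGroup Z] [Module A Z] {f : X →ₗ[A] Y} {g : Y →ₗ[A] Z}
    (h : Function.Exact f g) (hf : Function.Injective f) (hg : Function.Surjective g) :
    (exactSC h).ShortExact :=
  ModuleCat.shortComplex_shortExact _ h hf hg

/-- An injective hull does not change the homomorphisms from a simple module. -/
theorem range_le_of_essential {k C J : Type u} [AddCommGroup k] [Module A k] [IsSimpleModule A k]
    [AddCommGroup C] [Module A C] [AddCommGroup J] [Module A J] (ι : C →ₗ[A] J)
    (hess : ∀ S : Submodule A J, S ⊓ LinearMap.range ι = ⊥ → S = ⊥) (f : k →ₗ[A] J) :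
    LinearMap.range f ≤ LinearMap.range ι := by
  rintro _ ⟨x, rfl⟩
  rcases eq_bot_or_eq_top ((LinearMap.range ι).comap f) with h | h
  · have : LinearMap.range f = ⊥ := by
      refine hess _ ?_
      rw [Submodule.eq_bot_iff]
      rintro _ ⟨⟨y, rfl⟩, hy⟩
      have : y ∈ (LinearMap.range ι).comap f := hy
      rw [h] at this
      rw [(Submodule.mem_bot A).1 this, map_zero]
    have h2 : f x ∈ LinearMap.range f := ⟨x, rfl⟩
    rw [this] at h2
    rw [(Submodule.mem_bot A).1 h2]
    exact zero_mem _
  · have : x ∈ (LinearMap.range ι).comap f := h ▸ Submodule.mem_top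
    exact this

/-- Iterated cosyzygies along injective hulls: `Ext` into `M` is obtained by dimension shifting
from `Ext` into a module `C`, and the Bass numbers of `C` stay finite. -/
theorem exists_cosyzygy [IsNoetherianRing A] (k : Type u) [AddCommGroup k] [Module A k]
    [IsSimpleModule A k] (M : Type u) [AddCommGroup M] [Module A M]
    (hM : ∀ i, Module.Finite A (Ext (ModuleCat.of A k) (ModuleCat.of A M) i)) (d : ℕ) :
    ∃ (C : Type u) (_ : AddCommGroup C) (_ : Module A C)
      (κ : Ext (ModuleCat.of A C) (ModuleCat.of A M) d),
      (∀ i, Module.Finite A (Ext (ModuleCat.of A k) (ModuleCat.of A C) i)) ∧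
      ∀ (X : ModuleCat.{u} A) (i j : ℕ) (h : i + 1 + d = j), Function.Bijective
        (fun e : Ext X (ModuleCat.of A C) (i + 1) => e.comp κ h) := by
  induction d with
  | zero =>
    refine ⟨M, inferInstance, inferInstance, Ext.mk₀ (𝟙 _), hM, fun X i j h => ?_⟩
    subst h
    change Function.Bijective fun e : Ext X (ModuleCat.of A M) (i + 1) => e.comp _ (add_zero _)
    simp only [Ext.comp_mk₀_id]
    exact Function.bijective_id
  | succ d ih =>
    obtain ⟨C, _, _, κ, hC, hκ⟩ := ih
    obtain ⟨J, _, _, ι, hJ, hι, hess⟩ := exists_injective_hull (A := A) C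
    have hse := exactSC_shortExact (LinearMap.exact_map_mkQ_range ι) hι
      (Submodule.mkQ_surjective _)
    have hJ' : Injective (ModuleCat.of A J) := Module.injective_object_of_injective_module A J
    have : Injective (exactSC (LinearMap.exact_map_mkQ_range ι)).X₂ := hJ'
    refine ⟨J ⧸ LinearMap.range ι, inferInstance, inferInstance,
      hse.extClass.comp κ (add_comm 1 d), fun i => ?_, fun X i j hj => ?_⟩
    -- Ext^i(k, J/C) lies between Ext^i(k, J) and Ext^{i+1}(k, C). The former vanishes for i > 0.
    -- For i = 0 it is an image of Hom(k, C), because a map from a simple module into an essential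
    -- extension of C lands in C; this is why hulls rather than arbitrary injectives are used.
    · have h1 : Module.Finite A (Ext (ModuleCat.of A k) (ModuleCat.of A J) i) := by
        cases i with
        | zero =>
          have := hC 0
          refine Module.Finite.of_surjective ((Ext.mk₀ (ModuleCat.ofHom ι)).postcompOfLinear A
            (ModuleCat.of A k) (add_zero 0)) fun e => ?_
          obtain ⟨f, rfl⟩ := (Ext.mk₀_bijective _ _).2 e
          have hf := range_le_of_essential ι hess f.hom
          refine ⟨Ext.mk₀ (ModuleCat.ofHom ((LinearEquiv.ofInjective ι hι).symm.toLinearMap ∘ₗ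
            LinearMap.codRestrict (LinearMap.range ι) f.hom fun x => hf ⟨x, rfl⟩)), ?_⟩
          change Ext.comp _ _ (add_zero 0) = _
          rw [Ext.mk₀_comp_mk₀]
          congr 1
          ext x
          change ι ((LinearEquiv.ofInjective ι hι).symm _) = _
          rw [← LinearEquiv.ofInjective_apply (h := hι), LinearEquiv.apply_symm_apply]
          rfl
        | succ i =>
          have := Ext.subsingleton_of_injective (ModuleCat.of A k) (ModuleCat.of A J) i
          infer_instance
      have := hC (i + 1)
      refine finite_of_exact ((Ext.mk₀ (ModuleCat.ofHom
          (LinearMap.range ι).mkQ)).postcompOfLinear A (ModuleCat.of A k) (add_zero i))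
        (hse.extClass.postcompOfLinear A (ModuleCat.of A k) rfl) fun y hy => ?_
      exact Ext.covariant_sequence_exact₃ _ hse y rfl hy
    · have h1 : Function.Bijective (fun e : Ext X (ModuleCat.of A (J ⧸ LinearMap.range ι)) (i + 1) =>
          e.comp hse.extClass (show i + 1 + 1 = i + 1 + 1 from rfl)) := by
        constructor
        · intro a b hab
          rw [← sub_eq_zero]
          have h2 : (a - b).comp hse.extClass (show i + 1 + 1 = i + 1 + 1 from rfl) = 0 := by
            rw [sub_eq_add_neg, Ext.add_comp, Ext.neg_comp, ← sub_eq_add_neg, sub_eq_zero]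
            exact hab
          obtain ⟨c, hc⟩ := Ext.covariant_sequence_exact₃ _ hse _ rfl h2
          rw [← hc, Ext.eq_zero_of_injective c, Ext.zero_comp]
        · intro c
          exact Ext.covariant_sequence_exact₁ _ hse c (Ext.eq_zero_of_injective _) rfl
      convert (hκ X (i + 1) j (by omega)).comp h1 using 1
      ext e : 1
      exact (Ext.comp_assoc e hse.extClass κ rfl (add_comm 1 d) (by omega)).symm

/-! ### Regular sequences in A and coregular sequences on torsion submodules. -/

section

open RingTheory.Sequence IsLocalRing

/-- `ys` is obtained from `xs` by raising the entries to positive powers. -/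
abbrev IsPowList (xs ys : List A) : Prop := List.Forall₂ (fun x y => ∃ a : ℕ, y = x ^ (a + 1)) xs ys

/-- Over a Noetherian local ring regular sequences may be permuted, and the last entry may be
replaced by a power. Each entry is moved to the end, raised to its power and then moved into the
prefix `ys`. -/
theorem isWeaklyRegular_append_pow [IsLocalRing A] [IsNoetherianRing A] {xs zs : List A}
    (hp : IsPowList xs zs) (ys : List A) (h : IsWeaklyRegular A (ys ++ xs))
    (hm : ∀ x ∈ ys ++ xs, x ∈ maximalIdeal A) : IsWeaklyRegular A (ys ++ zs) := by
  induction hp generalizing ys with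
  | nil => exact h
  | @cons x z xs zs hxz _ ih =>
    obtain ⟨a, rfl⟩ := hxz
    have hperm : List.Perm (ys ++ x :: xs) ((ys ++ xs) ++ [x]) := by
      rw [List.append_assoc]
      exact List.Perm.append_left _ (List.perm_append_singleton x xs).symm
    have hj : ∀ l : List A, (∀ x ∈ l, x ∈ maximalIdeal A) →
        ∀ r ∈ l, r ∈ (Module.annihilator A A).jacobson := fun l hl r hr =>
      maximalIdeal_le_jacobson _ (hl r hr)
    have h1 := h.of_perm_of_subset_jacobson_annihilator hperm (hj _ hm)
    rw [isWeaklyRegular_append_iff, isWeaklyRegular_singleton_iff] at h1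
    have h2 : IsWeaklyRegular A ((ys ++ xs) ++ [x ^ (a + 1)]) := by
      rw [isWeaklyRegular_append_iff, isWeaklyRegular_singleton_iff]
      exact ⟨h1.1, h1.2.pow _⟩
    have hm' : ∀ y ∈ (ys ++ xs) ++ [x ^ (a + 1)], y ∈ maximalIdeal A := by
      intro y hy
      simp only [List.mem_append, List.mem_cons, List.not_mem_nil, or_false] at hy hm
      rcases hy with (hy | hy) | rfl
      · exact hm y (Or.inl hy)
      · exact hm y (Or.inr (Or.inr hy))
      · exact Ideal.pow_mem_of_mem _ (hm x (Or.inr (Or.inl rfl))) _ (Nat.succ_pos a)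
    have hperm2 : List.Perm ((ys ++ xs) ++ [x ^ (a + 1)]) ((ys ++ [x ^ (a + 1)]) ++ xs) := by
      rw [List.append_assoc, List.append_assoc]
      exact List.Perm.append_left _ (List.perm_append_singleton _ xs)
    have h3 := h2.of_perm_of_subset_jacobson_annihilator hperm2 (hj _ hm')
    simpa using ih _ h3 fun y hy => hm' y (hperm2.mem_iff.2 hy)

theorem subsingleton_ext_quotient_ofList [IsLocalRing A] [IsNoetherianRing A] {ys : List A}
    (h : IsWeaklyRegular A ys) (hm : ∀ y ∈ ys, y ∈ maximalIdeal A) (M : ModuleCat.{u} A) (j : ℕ)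
    (hj : ys.length < j) : Subsingleton (Ext (ModuleCat.of A (A ⧸ Ideal.ofList ys)) M j) := by
  have h1 := ModuleCat.projectiveDimension_quotient_eq_add_length_of_isWeaklyRegular
    (ModuleCat.of A A) ys h hm
  have h0 : projectiveDimension (ModuleCat.of A A) ≤ (0 : ℕ) := by
    have : Projective (ModuleCat.of A A) := ModuleCat.projective_of_free (Module.Basis.singleton PUnit.{1} A)
    rw [projectiveDimension_le_iff]
    infer_instance
  have h2 : HasProjectiveDimensionLE
      (ModuleCat.of A (A ⧸ (Ideal.ofList ys • (⊤ : Submodule A A)))) ys.length := by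
    rw [← projectiveDimension_le_iff]
    refine h1.le.trans ?_
    exact (add_le_add_left h0 _).trans_eq (zero_add _)
  have h3 : Ideal.ofList ys • (⊤ : Submodule A A) = Ideal.ofList ys := by simp
  rw [h3] at h2
  exact HasProjectiveDimensionLT.subsingleton _ (ys.length + 1) j hj _

/-- The submodule of elements killed by a power of `I`. -/
def powTorsion (I : Ideal A) (C : Type u) [AddCommGroup C] [Module A C] : Submodule A C where
  carrier := {c | ∃ n : ℕ, ∀ a ∈ I ^ n, a • c = 0}
  zero_mem' := ⟨0, fun _ _ => smul_zero _⟩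
  add_mem' := by
    rintro x y ⟨n, hn⟩ ⟨m, hm⟩
    refine ⟨n + m, fun a ha => ?_⟩
    rw [smul_add, hn a (Ideal.pow_le_pow_right (Nat.le_add_right n m) ha),
      hm a (Ideal.pow_le_pow_right (Nat.le_add_left m n) ha), add_zero]
  smul_mem' := by
    rintro r x ⟨n, hn⟩
    exact ⟨n, fun a ha => by rw [smul_comm, hn a ha, smul_zero]⟩

/-- The map `A ⧸ J → C` sending `1` to an element killed by `J`. -/
def quotLift {C : Type u} [AddCommGroup C] [Module A C] (J : Ideal A) (c : C)
    (h : ∀ a ∈ J, a • c = 0) : (A ⧸ J) →ₗ[A] C :=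
  Submodule.liftQ J (LinearMap.toSpanSingleton A C c) fun a ha => h a ha

theorem quotLift_mk {C : Type u} [AddCommGroup C] [Module A C] (J : Ideal A) (c : C)
    (h : ∀ a ∈ J, a • c = 0) (a : A) : quotLift J c h (Submodule.Quotient.mk a) = a • c := rfl

/-- If `Ext¹` of the third term vanishes, maps from the first term extend to the second. -/
theorem exists_extension_of_ext {X Y Z C : Type u} [AddCommGroup X] [Module A X]
    [AddCommGroup Y] [Module A Y] [AddCommGroup Z] [Module A Z] [AddCommGroup C] [Module A C]
    {f : X →ₗ[A] Y} {g : Y →ₗ[A] Z}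
    (h : Function.Exact f g) (hf : Function.Injective f) (hg : Function.Surjective g)
    [Subsingleton (Ext (ModuleCat.of A Z) (ModuleCat.of A C) 1)] (u : X →ₗ[A] C) :
    ∃ v : Y →ₗ[A] C, v ∘ₗ f = u := by
  have hse := exactSC_shortExact h hf hg
  obtain ⟨e, he⟩ := Ext.contravariant_sequence_exact₁ hse (ModuleCat.of A C)
    (Ext.mk₀ (ModuleCat.ofHom u)) (n₁ := 1) (add_zero 1)
    (Subsingleton.elim (α := Ext (ModuleCat.of A Z) (ModuleCat.of A C) 1) _ _)
  obtain ⟨v, rfl⟩ := (Ext.mk₀_bijective _ _).2 e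
  rw [Ext.mk₀_comp_mk₀] at he
  exact ⟨v.hom, congrArg ModuleCat.Hom.hom ((Ext.mk₀_bijective _ _).1 he)⟩

/-- If `Ext¹` into the first term vanishes, maps to the third term lift to the second. -/
theorem exists_lift_of_ext {X Y Z C : Type u} [AddCommGroup X] [Module A X]
    [AddCommGroup Y] [Module A Y] [AddCommGroup Z] [Module A Z] [AddCommGroup C] [Module A C]
    {f : X →ₗ[A] Y} {g : Y →ₗ[A] Z}
    (h : Function.Exact f g) (hf : Function.Injective f) (hg : Function.Surjective g)
    [Subsingleton (Ext (ModuleCat.of A C) (ModuleCat.of A X) 1)] (u : C →ₗ[A] Z) :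
    ∃ v : C →ₗ[A] Y, g ∘ₗ v = u := by
  have hse := exactSC_shortExact h hf hg
  obtain ⟨e, he⟩ := Ext.covariant_sequence_exact₃ (ModuleCat.of A C) hse 
    (Ext.mk₀ (ModuleCat.ofHom u)) (n₁ := 1) (zero_add 1)
    (Subsingleton.elim (α := Ext (ModuleCat.of A C) (ModuleCat.of A X) 1) _ _)
  obtain ⟨v, rfl⟩ := (Ext.mk₀_bijective _ _).2 e
  rw [Ext.mk₀_comp_mk₀] at he
  exact ⟨v.hom, congrArg ModuleCat.Hom.hom ((Ext.mk₀_bijective _ _).1 he)⟩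

/-- Divisibility of the elements killed by `J` and a power of `x`. -/
theorem exists_smul_eq_of_ext {C : Type u} [AddCommGroup C] [Module A C] (J : Ideal A) (x : A)
    (hx : IsSMulRegular (A ⧸ J) x)
    [Subsingleton (Ext (ModuleCat.of A (A ⧸ (J ⊔ Ideal.span {x}))) (ModuleCat.of A C) 1)]
    (k : ℕ) (z : C) (hJ : ∀ a ∈ J, a • z = 0) (hz : x ^ k • z = 0) :
    ∃ w : C, (∀ a ∈ J, a • w = 0) ∧ x ^ (k + 1) • w = 0 ∧ x • w = z := by
  let J₁ := J ⊔ Ideal.span {x ^ k}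
  let J₂ := J ⊔ Ideal.span {x ^ (k + 1)}
  let J₃ := J ⊔ Ideal.span {x}
  have mem_sup : ∀ y b : A, b ∈ J ⊔ Ideal.span {y} ↔ ∃ c, b - c * y ∈ J := fun y b => by
    rw [Submodule.mem_sup]
    constructor
    · rintro ⟨j, hj, i, hi, rfl⟩
      obtain ⟨c, rfl⟩ := Ideal.mem_span_singleton'.1 hi
      exact ⟨c, by simpa using hj⟩
    · rintro ⟨c, hc⟩
      exact ⟨_, hc, c * y, Ideal.mem_span_singleton'.2 ⟨c, rfl⟩, by ring⟩
  -- The sequence 0 → A/(J, x^k) → A/(J, x^{k+1}) → A/(J, x) → 0, with first map multiplication by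
  -- x, is exact because x is regular modulo J. The element z is a map from its first term;
  -- extending it to the middle term produces w as the image of 1.
  let f : (A ⧸ J₁) →ₗ[A] (A ⧸ J₂) := Submodule.mapQ J₁ J₂ (LinearMap.lsmul A A x) (by
    intro b hb
    obtain ⟨c, hc⟩ := (mem_sup _ _).1 hb
    rw [Submodule.mem_comap, LinearMap.lsmul_apply, smul_eq_mul]
    refine (mem_sup _ _).2 ⟨c, ?_⟩
    have := J.mul_mem_left x hc
    convert this using 1; ring)
  have h23 : J₂ ≤ J₃ := by
    intro b hb
    obtain ⟨c, hc⟩ := (mem_sup _ _).1 hb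
    exact (mem_sup _ _).2 ⟨c * x ^ k, by convert hc using 1; ring⟩
  let g : (A ⧸ J₂) →ₗ[A] (A ⧸ J₃) := Submodule.factor h23
  have hf : Function.Injective f := by
    rw [← LinearMap.ker_eq_bot, Submodule.eq_bot_iff]
    intro b hb
    obtain ⟨b, rfl⟩ := Submodule.Quotient.mk_surjective _ b
    have : x * b ∈ J₂ := (Submodule.Quotient.mk_eq_zero J₂).1 hb
    obtain ⟨c, hc⟩ := (mem_sup _ _).1 this
    refine (Submodule.Quotient.mk_eq_zero J₁).2 ((mem_sup _ _).2 ⟨c, ?_⟩)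
    refine mem_of_isSMulRegular_quotient_of_smul_mem hx ?_
    rw [smul_eq_mul]
    convert hc using 1; ring
  have hfg : Function.Exact f g := by
    intro b
    obtain ⟨b, rfl⟩ := Submodule.Quotient.mk_surjective _ b
    constructor
    · intro hb
      have : b ∈ J₃ := (Submodule.Quotient.mk_eq_zero J₃).1 hb
      obtain ⟨c, hc⟩ := (mem_sup _ _).1 this
      refine ⟨Submodule.Quotient.mk c, ?_⟩
      refine ((Submodule.Quotient.eq J₂).2 ?_).symm
      refine (mem_sup _ _).2 ⟨0, ?_⟩
      rw [LinearMap.lsmul_apply, smul_eq_mul]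
      convert hc using 1; ring
    · rintro ⟨c, hc⟩
      obtain ⟨c, rfl⟩ := Submodule.Quotient.mk_surjective _ c
      have : x * c - b ∈ J₂ := (Submodule.Quotient.eq J₂).1 hc
      refine (Submodule.Quotient.mk_eq_zero J₃).2 ?_
      have h2 : x * c ∈ J₃ := (mem_sup _ _).2 ⟨c, by simp [mul_comm]⟩
      simpa using J₃.sub_mem h2 (h23 this)
  obtain ⟨v, hv⟩ := exists_extension_of_ext hfg hf (Submodule.factor_surjective h23)
    (quotLift J₁ z (by
      intro b hb
      obtain ⟨c, hc⟩ := (mem_sup _ _).1 hb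
      have := hJ _ hc
      rwa [sub_smul, mul_smul, hz, smul_zero, sub_zero] at this))
  have hv2 : ∀ b ∈ J₂, b • v (Submodule.Quotient.mk 1) = 0 := by
    intro b hb
    rw [← map_smul, ← Submodule.Quotient.mk_smul, smul_eq_mul, mul_one,
      (Submodule.Quotient.mk_eq_zero J₂).2 hb, map_zero]
  refine ⟨v (Submodule.Quotient.mk 1), fun a ha => hv2 a (Ideal.mem_sup_left ha),
    hv2 _ (Ideal.mem_sup_right (Ideal.mem_span_singleton_self _)), ?_⟩
  have := LinearMap.congr_fun hv (Submodule.Quotient.mk 1)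
  rw [quotLift_mk, one_smul, LinearMap.comp_apply] at this
  rw [← this, ← map_smul]
  rfl

/-- A sequence is coregular on `K` if each entry acts surjectively on the submodule of `K` killed
by the previous entries. -/
def IsCoregular {C : Type u} [AddCommGroup C] [Module A C] : List A → Submodule A C → Prop
  | [], _ => True
  | x :: xs, K => (∀ z ∈ K, ∃ w ∈ K, x • w = z) ∧
      IsCoregular xs (K ⊓ LinearMap.ker (LinearMap.lsmul A C x))

/-- If x is onto on K, the sequence 0 → K[x] → K → K → 0 is exact. As x kills N it kills Ext(N, K),
so the connecting map Ext^j(N, K) → Ext^{j+1}(N, K[x]) is injective. Each entry raises the degree by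
one until the vanishing hypothesis applies. -/
theorem subsingleton_ext_of_isCoregular {C : Type u} [AddCommGroup C] [Module A C] (N : Type u)
    [AddCommGroup N] [Module A N] (xs : List A) (hxs : ∀ x ∈ xs, x ∈ Module.annihilator A N)
    (K : Submodule A C) (hK : IsCoregular xs K) (j : ℕ)
    (hN : ∀ X : ModuleCat.{u} A, Subsingleton (Ext (ModuleCat.of A N) X (j + xs.length))) :
    Subsingleton (Ext (ModuleCat.of A N) (ModuleCat.of A K) j) := by
  induction xs generalizing K j with
  | nil => exact hN _
  | cons x xs ih =>
    have := ih (fun y hy => hxs y (List.mem_cons_of_mem _ hy)) _ hK.2 (j + 1)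
      (fun X => by have := hN X; rwa [List.length_cons, ← add_assoc, add_right_comm] at this)
    let f : ↥(K ⊓ LinearMap.ker (LinearMap.lsmul A C x)) →ₗ[A] K := Submodule.inclusion inf_le_left
    let g : K →ₗ[A] K := x • LinearMap.id
    have hfg : Function.Exact f g := by
      intro y
      constructor
      · intro hy
        exact ⟨⟨y, y.2, congrArg Subtype.val hy⟩, rfl⟩
      · rintro ⟨y, rfl⟩
        exact Subtype.ext y.2.2
    have hse := exactSC_shortExact hfg (Submodule.inclusion_injective _) (fun z => by
      obtain ⟨w, hw, hwz⟩ := hK.1 z z.2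
      exact ⟨⟨w, hw⟩, Subtype.ext hwz⟩)
    refine ⟨fun a b => ?_⟩
    have hz : ∀ e : Ext (ModuleCat.of A N) (ModuleCat.of A K) j, x • e = 0 := by
      intro e
      have h1 : x • 𝟙 (ModuleCat.of A N) = 0 := by
        ext n
        exact Module.mem_annihilator.1 (hxs x List.mem_cons_self) n
      rw [← Ext.mk₀_id_comp e, ← Ext.smul_comp, ← Ext.mk₀_smul, h1, Ext.mk₀_zero, Ext.zero_comp]
    -- The next obstruction group is zero, so `e` is x times some `e'`, and x annihilates the group.
    have h0 : ∀ e : Ext (ModuleCat.of A N) (ModuleCat.of A K) j, e = 0 := by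
      intro e
      obtain ⟨e', he'⟩ := Ext.covariant_sequence_exact₃ (ModuleCat.of A N) hse e rfl
        (Subsingleton.elim _ _)
      rw [← he', ← hz e', Ext.smul_eq_comp_mk₀]
      rfl
    rw [h0 a, h0 b]

/-- The submodule of elements of `K` killed by the entries of a list. -/
def killedBy {C : Type u} [AddCommGroup C] [Module A C] (K : Submodule A C) (xs : List A) :
    Submodule A C where
  carrier := {c | c ∈ K ∧ ∀ x ∈ xs, x • c = 0}
  zero_mem' := ⟨zero_mem _, fun _ _ => smul_zero _⟩
  add_mem' := by
    rintro a b ⟨ha, ha'⟩ ⟨hb, hb'⟩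
    exact ⟨add_mem ha hb, fun x hx => by rw [smul_add, ha' x hx, hb' x hx, add_zero]⟩
  smul_mem' := by
    rintro r a ⟨ha, ha'⟩
    exact ⟨K.smul_mem r ha, fun x hx => by rw [smul_comm, ha' x hx, smul_zero]⟩

theorem smul_eq_zero_of_ofList {C : Type u} [AddCommGroup C] [Module A C] {ys : List A} {c : C}
    (h : ∀ y ∈ ys, y • c = 0) : ∀ a ∈ Ideal.ofList ys, a • c = 0 := by
  have : Ideal.ofList ys ≤ LinearMap.ker (LinearMap.toSpanSingleton A C c) :=
    Ideal.span_le.2 fun y hy => h y hy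
  exact fun a ha => this ha

theorem isPowList_self_append {pre post : List A} (k : ℕ) :
    IsPowList (pre ++ post) (pre ++ post.map (· ^ (k + 1))) := by
  refine List.rel_append (List.forall₂_same.2 fun x _ => ⟨0, by simp⟩) ?_
  rw [List.forall₂_map_right_iff]
  exact List.forall₂_same.2 fun x _ => ⟨k, rfl⟩

/-- A torsion element z is killed by high powers of all entries. Replacing the entries after x by
such powers puts z in the situation of `exists_smul_eq_of_ext`, whose solution w is then killed by
an 𝔪-primary ideal and so is again torsion. -/
theorem exists_mem_killedBy [IsLocalRing A] [IsNoetherianRing A] {C : Type u} [AddCommGroup C]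
    [Module A C] {pre post : List A} {x : A}
    (hreg : IsWeaklyRegular A (pre ++ x :: post)) (hm : ∀ y ∈ pre ++ x :: post, y ∈ maximalIdeal A)
    (hrad : ∃ t, maximalIdeal A ^ t ≤ Ideal.ofList (pre ++ x :: post))
    (hC : ∀ ys, IsPowList (pre ++ x :: post) ys →
      Subsingleton (Ext (ModuleCat.of A (A ⧸ Ideal.ofList ys)) (ModuleCat.of A C) 1))
    (z : C) (hz : z ∈ killedBy (powTorsion (maximalIdeal A) C) pre) :
    ∃ w ∈ killedBy (powTorsion (maximalIdeal A) C) pre, x • w = z := by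
  obtain ⟨⟨n, hn⟩, hpre⟩ := hz
  have hmem : ∀ y ∈ pre ++ x :: post, y ^ (n + 1) • z = 0 := fun y hy => by
    rw [pow_succ', mul_smul, hn _ (Ideal.pow_mem_pow (hm y hy) n), smul_zero]
  let ys := pre ++ post.map (· ^ (n + 1))
  have hperm : List.Perm (pre ++ x :: post) ((pre ++ post) ++ [x]) := by
    rw [List.append_assoc]
    exact List.Perm.append_left _ (List.perm_append_singleton x post).symm
  have h1 : IsWeaklyRegular A ([x] ++ (pre ++ post)) := by
    refine hreg.of_perm_of_subset_jacobson_annihilator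
      (hperm.trans List.perm_append_comm) fun r hr => maximalIdeal_le_jacobson _ (hm r hr)
  have hm1 : ∀ y ∈ [x] ++ (pre ++ post), y ∈ maximalIdeal A := fun y hy =>
    hm y ((hperm.trans List.perm_append_comm).mem_iff.2 hy)
  have h2 := isWeaklyRegular_append_pow (isPowList_self_append (post := post) n) [x] h1 hm1
  -- Moving x to the end of the sequence is what makes it regular modulo the ideal of `ys`.
  have h3 : IsWeaklyRegular A (ys ++ [x]) := by
    refine h2.of_perm_of_subset_jacobson_annihilator List.perm_append_comm
      fun r hr => maximalIdeal_le_jacobson _ ?_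
    simp only [List.mem_append, List.mem_cons, List.not_mem_nil, or_false, List.mem_map] at hr hm1
    rcases hr with rfl | hr | ⟨b, hb, rfl⟩
    · exact hm1 _ (Or.inl rfl)
    · exact hm1 _ (Or.inr (Or.inl hr))
    · exact Ideal.pow_mem_of_mem _ (hm1 _ (Or.inr (Or.inr hb))) _ (Nat.succ_pos n)
  rw [isWeaklyRegular_append_iff, isWeaklyRegular_singleton_iff] at h3
  have hx := h3.2
  have htop : Ideal.ofList ys • (⊤ : Submodule A A) = Ideal.ofList ys := by simp
  rw [htop] at hx
  have hsub : Subsingleton (Ext (ModuleCat.of A (A ⧸ (Ideal.ofList ys ⊔ Ideal.span {x})))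
      (ModuleCat.of A C) 1) := by
    have h4 : Ideal.ofList ys ⊔ Ideal.span {x} =
        Ideal.ofList (pre ++ x :: post.map (· ^ (n + 1))) := by
      rw [← Ideal.ofList_singleton, ← Ideal.ofList_append]
      refine congrArg Ideal.span (Set.ext fun y => ?_)
      simp only [Set.mem_ofPred_eq, ys, List.mem_append, List.mem_cons, List.not_mem_nil, or_false]
      tauto
    rw [h4]
    refine hC _ (List.rel_append (List.forall₂_same.2 fun x _ => ⟨0, by simp⟩)
      (List.Forall₂.cons ⟨0, by simp⟩ ?_))
    rw [List.forall₂_map_right_iff]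
    exact List.forall₂_same.2 fun x _ => ⟨n, rfl⟩
  obtain ⟨w, hw1, hw2, hw3⟩ := exists_smul_eq_of_ext (Ideal.ofList ys) x hx (n + 1) z
    (smul_eq_zero_of_ofList (by
      intro y hy
      rcases List.mem_append.1 hy with hy | hy
      · exact hpre y hy
      · obtain ⟨b, hb, rfl⟩ := List.mem_map.1 hy
        exact hmem b (by simp [hb]))) (hmem x (by simp))
  refine ⟨w, ⟨?_, fun y hy => hw1 y (Ideal.subset_span (List.mem_append_left _ hy))⟩, hw3⟩
  obtain ⟨t, ht⟩ := hrad
  -- `w` is killed by `ys` and by `x ^ (n + 2)`; this ideal has every original entry in its radical,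
  -- so it contains a power of 𝔪.
  have hle : Ideal.ofList (pre ++ x :: post) ≤
      (Ideal.ofList ys ⊔ Ideal.span {x ^ (n + 1 + 1)}).radical := by
    refine Ideal.span_le.2 fun y hy => ?_
    simp only [Set.mem_ofPred_eq, List.mem_append, List.mem_cons] at hy
    rcases hy with hy | rfl | hy
    · exact Ideal.le_radical (Ideal.mem_sup_left (Ideal.subset_span (List.mem_append_left _ hy)))
    · exact ⟨n + 1 + 1, Ideal.mem_sup_right (Ideal.mem_span_singleton_self _)⟩
    · exact ⟨n + 1, Ideal.mem_sup_left (Ideal.subset_span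
        (List.mem_append_right _ (List.mem_map.2 ⟨y, hy, rfl⟩)))⟩
  obtain ⟨s, hs⟩ := Ideal.exists_pow_le_of_le_radical_of_fg hle (IsNoetherian.noetherian _)
  refine ⟨t * s, fun a ha => ?_⟩
  rw [pow_mul] at ha
  obtain ⟨b, hb, c, hc, rfl⟩ := Submodule.mem_sup.1 (hs (Ideal.pow_right_mono ht s ha))
  obtain ⟨c, rfl⟩ := Ideal.mem_span_singleton'.1 hc
  rw [add_smul, hw1 b hb, mul_smul, hw2, smul_zero, add_zero]

theorem isCoregular_powTorsion [IsLocalRing A] [IsNoetherianRing A] {C : Type u} [AddCommGroup C]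
    [Module A C] (pre xs post : List A)
    (hreg : IsWeaklyRegular A (pre ++ xs ++ post))
    (hm : ∀ y ∈ pre ++ xs ++ post, y ∈ maximalIdeal A)
    (hrad : ∃ t, maximalIdeal A ^ t ≤ Ideal.ofList (pre ++ xs ++ post))
    (hC : ∀ ys, IsPowList (pre ++ xs ++ post) ys →
      Subsingleton (Ext (ModuleCat.of A (A ⧸ Ideal.ofList ys)) (ModuleCat.of A C) 1)) :
    IsCoregular xs (killedBy (powTorsion (maximalIdeal A) C) pre) := by
  induction xs generalizing pre with
  | nil => trivial
  | cons x xs ih =>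
    have e1 : pre ++ x :: xs ++ post = pre ++ x :: (xs ++ post) := by simp
    have e2 : pre ++ x :: xs ++ post = (pre ++ [x]) ++ xs ++ post := by simp
    refine ⟨?_, ?_⟩
    · rw [e1] at hreg hm hrad hC
      exact exists_mem_killedBy hreg hm hrad hC
    · rw [e2] at hreg hm hrad hC
      have h3 : killedBy (powTorsion (maximalIdeal A) C) pre ⊓
          LinearMap.ker (LinearMap.lsmul A C x) =
            killedBy (powTorsion (maximalIdeal A) C) (pre ++ [x]) := by
        ext c
        constructor
        · rintro ⟨⟨h, h'⟩, h''⟩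
          refine ⟨h, fun y hy => ?_⟩
          rcases List.mem_append.1 hy with hy | hy
          · exact h' y hy
          · rw [List.mem_singleton.1 hy]; exact h''
        · rintro ⟨h, h'⟩
          exact ⟨⟨h, fun y hy => h' y (List.mem_append_left _ hy)⟩, h' x (by simp)⟩
      rw [h3]
      exact ih _ hreg hm hrad hC

/-! ### Extension classes that come from the torsion submodule. -/

/-- The short exact sequence of a submodule and its quotient. -/
theorem submodule_shortExact {N : Type u} [AddCommGroup N] [Module A N] (U : Submodule A N) :
    (exactSC (LinearMap.exact_subtype_mkQ U)).ShortExact :=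
  exactSC_shortExact _ U.injective_subtype U.mkQ_surjective

/-- Extension classes of a module whose elements are killed by ideals `𝔮` with
`Ext¹(A ⧸ 𝔮, C) = 0` come from the torsion submodule of `C`. -/
theorem exists_hom_extClass_eq {C N : Type u} [AddCommGroup C] [Module A C] [AddCommGroup N]
    [Module A N] (U : Submodule A N) (I : Ideal A)
    [Subsingleton (Ext (ModuleCat.of A N) (ModuleCat.of A (powTorsion I C)) 1)]
    (hU : ∀ x : N, ∃ J : Ideal A, (∀ a ∈ J, a • x ∈ U) ∧ (∃ t, I ^ t ≤ J) ∧
      Subsingleton (Ext (ModuleCat.of A (A ⧸ J)) (ModuleCat.of A C) 1))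
    (e : Ext (ModuleCat.of A (N ⧸ U)) (ModuleCat.of A C) 1) :
    ∃ g : U →ₗ[A] powTorsion I C, (submodule_shortExact U).extClass.comp
      (Ext.mk₀ (ModuleCat.ofHom ((powTorsion I C).subtype ∘ₗ g))) (add_zero 1) = e := by
  obtain ⟨J, _, _, ι, hJ, hι, -⟩ := exists_injective_hull (A := A) C
  have hexact := LinearMap.exact_map_mkQ_range ι
  have hsurj := Submodule.mkQ_surjective (LinearMap.range ι)
  have hse := exactSC_shortExact hexact hι hsurj
  have hJ' : Injective (ModuleCat.of A J) := Module.injective_object_of_injective_module A J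
  have : Injective (exactSC hexact).X₂ := hJ'
  obtain ⟨h, hh⟩ := Ext.covariant_sequence_exact₁ (ModuleCat.of A (N ⧸ U)) hse e
    (Ext.eq_zero_of_injective _) (zero_add 1)
  obtain ⟨h, rfl⟩ := (Ext.mk₀_bijective _ _).2 h
  let h' : (N ⧸ U) →ₗ[A] (J ⧸ LinearMap.range ι) := h.hom
  let Q := LinearMap.range ι
  -- The class is represented by h : N/U → J/C. Each value of h is a map from some A/𝔮, which lifts
  -- to J because Ext¹(A/𝔮, C) = 0; the lift is torsion because 𝔮 contains a power of I.
  have hlift : ∀ x : N, h' (U.mkQ x) ∈ (powTorsion I J).map Q.mkQ := by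
    intro x
    obtain ⟨𝔮, hq, ⟨t, ht⟩, _⟩ := hU x
    obtain ⟨v, hv⟩ := exists_lift_of_ext hexact hι hsurj (quotLift 𝔮 (h' (U.mkQ x)) (by
      intro a ha
      rw [← map_smul, ← map_smul, Submodule.mkQ_apply, (Submodule.Quotient.mk_eq_zero U).2 (hq a ha),
        map_zero]))
    refine ⟨v (Submodule.Quotient.mk 1), ⟨t, fun a ha => ?_⟩, ?_⟩
    · rw [← map_smul, ← Submodule.Quotient.mk_smul, smul_eq_mul, mul_one,
        (Submodule.Quotient.mk_eq_zero 𝔮).2 (ht ha), map_zero]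
    · have := LinearMap.congr_fun hv (Submodule.Quotient.mk 1)
      rwa [quotLift_mk, one_smul] at this
  let G := (powTorsion I J).map Q.mkQ
  let p : powTorsion I J →ₗ[A] G :=
    LinearMap.codRestrict G (Q.mkQ ∘ₗ (powTorsion I J).subtype) fun x => ⟨x, x.2, rfl⟩
  have hιt : ∀ c : powTorsion I C, ι c ∈ powTorsion I J := by
    rintro ⟨c, n, hn⟩
    exact ⟨n, fun a ha => by rw [← map_smul, hn a ha, map_zero]⟩
  let f : powTorsion I C →ₗ[A] powTorsion I J :=
    LinearMap.codRestrict _ (ι ∘ₗ (powTorsion I C).subtype) hιt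
  have hker : ∀ y : powTorsion I J, Q.mkQ y = 0 → ∃ c : powTorsion I C, ι c = y := by
    rintro ⟨y, n, hn⟩ hy
    obtain ⟨c, rfl⟩ := (Submodule.Quotient.mk_eq_zero Q).1 hy
    exact ⟨⟨c, n, fun a ha => hι (by rw [map_smul, hn a ha, map_zero])⟩, rfl⟩
  have hfp : Function.Exact f p := by
    intro y
    constructor
    · intro hy
      obtain ⟨c, hc⟩ := hker y (congrArg Subtype.val hy)
      exact ⟨c, Subtype.ext hc⟩
    · rintro ⟨c, rfl⟩
      exact Subtype.ext ((Submodule.Quotient.mk_eq_zero Q).2 ⟨c, rfl⟩)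
  have hfinj : Function.Injective f := fun a b hab =>
    Subtype.ext (hι (congrArg Subtype.val hab))
  have hpsurj : Function.Surjective p := by
    rintro ⟨_, y, hy, rfl⟩
    exact ⟨⟨y, hy⟩, rfl⟩
  -- The pointwise lifts give a map from N into G = Γ(J)/Γ(C), where Γ denotes I-power torsion.
  -- Vanishing of Ext¹(N, Γ(C)) lifts it to a single map t : N → Γ(J), and t sends U into Γ(C).
  obtain ⟨t, ht⟩ := exists_lift_of_ext hfp hfinj hpsurj
    (LinearMap.codRestrict G (h' ∘ₗ U.mkQ) hlift)
  have ht' : ∀ x, Q.mkQ (t x) = h' (U.mkQ x) := fun x => congrArg Subtype.val (LinearMap.congr_fun ht x)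
  have hg : ∀ x : U, (t x : J) ∈ LinearMap.range (ι ∘ₗ (powTorsion I C).subtype) := by
    intro x
    obtain ⟨c, hc⟩ := hker (t x) (by
      rw [ht', Submodule.mkQ_apply, (Submodule.Quotient.mk_eq_zero U).2 x.2, map_zero])
    exact ⟨c, hc⟩
  have hinj : Function.Injective (ι ∘ₗ (powTorsion I C).subtype) :=
    hι.comp (powTorsion I C).injective_subtype
  let g : U →ₗ[A] powTorsion I C := (LinearEquiv.ofInjective _ hinj).symm.toLinearMap ∘ₗ
    LinearMap.codRestrict _ ((powTorsion I J).subtype ∘ₗ t ∘ₗ U.subtype) hg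
  have hgt : ∀ x : U, ι (g x) = t x := by
    intro x
    change (ι ∘ₗ (powTorsion I C).subtype) ((LinearEquiv.ofInjective _ hinj).symm _) = _
    rw [← LinearEquiv.ofInjective_apply (h := hinj), LinearEquiv.apply_symm_apply]
    rfl
  refine ⟨g, ?_⟩
  -- The maps g, t, h form a morphism from 0 → U → N → N/U → 0 to 0 → C → J → J/C → 0, and
  -- naturality of the extension class finishes.
  let φ : exactSC (LinearMap.exact_subtype_mkQ U) ⟶ exactSC hexact :=
    { τ₁ := ModuleCat.ofHom ((powTorsion I C).subtype ∘ₗ g)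
      τ₂ := ModuleCat.ofHom ((powTorsion I J).subtype ∘ₗ t)
      τ₃ := h
      comm₁₂ := by
        ext x
        exact hgt x
      comm₂₃ := by
        ext x
        exact ht' x }
  exact ((submodule_shortExact U).extClass_naturality hse φ).trans hh

end

/-! ### The regular sequence attached to a perfect module, and the torsion module K. -/

section

open RingTheory.Sequence IsLocalRing

theorem subsingleton_ext_of_linearEquiv {N : ModuleCat.{u} A} {M M' : Type u} [AddCommGroup M]
    [Module A M] [AddCommGroup M'] [Module A M'] (e : M ≃ₗ[A] M') {i : ℕ}
    (h : Subsingleton (Ext N (ModuleCat.of A M) i)) : Subsingleton (Ext N (ModuleCat.of A M') i) := by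
  refine Function.Injective.subsingleton (β := Ext N (ModuleCat.of A M) i)
    (f := fun x => x.comp (Ext.mk₀ (ModuleCat.ofHom e.symm.toLinearMap)) (add_zero i)) ?_
  refine Function.LeftInverse.injective
    (g := fun x => x.comp (Ext.mk₀ (ModuleCat.ofHom e.toLinearMap)) (add_zero i)) fun x => ?_
  change Ext.comp (Ext.comp _ _ _) _ _ = _
  rw [Ext.comp_assoc_of_third_deg_zero, Ext.mk₀_comp_mk₀, ← ModuleCat.ofHom_comp]
  simp

/-- By the long exact sequence of multiplication by a regular element, each entry costs one degree
of vanishing. -/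
theorem subsingleton_ext_quotient_of_isWeaklyRegular (N : ModuleCat.{u} A) (xs : List A) (M : Type u)
    [AddCommGroup M] [Module A M] (hreg : IsWeaklyRegular M xs) (n : ℕ)
    (h : ∀ i < n + xs.length, Subsingleton (Ext N (ModuleCat.of A M) i)) :
    ∀ i < n, Subsingleton
      (Ext N (ModuleCat.of A (M ⧸ Ideal.ofList xs • (⊤ : Submodule A M))) i) := by
  induction xs generalizing M with
  | nil =>
    intro i hi
    have := h i hi
    refine subsingleton_ext_of_linearEquiv (Submodule.quotEquivOfEqBot _ ?_).symm this
    simp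
  | cons x xs ih =>
    intro i hi
    rw [isWeaklyRegular_cons_iff] at hreg
    refine subsingleton_ext_of_linearEquiv
      (Submodule.quotOfListConsSMulTopEquivQuotSMulTopInner M x xs).symm ?_
    refine ih (QuotSMulTop x M) hreg.2 (fun j hj => ?_) i hi
    have h1 := h j (by simp; omega)
    have h2 := h (j + 1) (by simp; omega)
    have hse := hreg.1.smulShortComplex_shortExact (M := ModuleCat.of A M)
    refine ⟨fun a b => ?_⟩
    have h0 : ∀ e : Ext N (ModuleCat.of A (QuotSMulTop x M)) j, e = 0 := by
      intro e
      obtain ⟨e', he'⟩ := Ext.covariant_sequence_exact₃ N hse e rfl (Subsingleton.elim (α := Ext N (ModuleCat.of A M) (j + 1)) _ _)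
      have he0 : e' = 0 := Subsingleton.elim (α := Ext N (ModuleCat.of A M) j) e' 0
      rw [← he', he0, Ext.zero_comp]
      rfl
    rw [h0 a, h0 b]

theorem exists_pow_maximalIdeal_le [IsLocalRing A] [IsNoetherianRing A] (J : Ideal A)
    (h : ringKrullDim (A ⧸ J) ≤ 0) : ∃ t, maximalIdeal A ^ t ≤ J := by
  refine Ideal.exists_pow_le_of_le_radical_of_fg ?_ (IsNoetherian.noetherian _)
  have : Ring.KrullDimLE 0 (A ⧸ J) := by
    rw [Ring.krullDimLE_iff]; exact h
  rw [Ideal.radical_eq_sInf]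
  refine le_sInf fun P hP => ?_
  obtain ⟨hJP, hPp⟩ := hP
  have hmax : (P.map (Ideal.Quotient.mk J)).IsMaximal := by
    have : (P.map (Ideal.Quotient.mk J)).IsPrime :=
      Ideal.map_isPrime_of_surjective Ideal.Quotient.mk_surjective (by simpa using hJP)
    exact Ideal.IsPrime.isMaximal' this
  have := Ideal.comap_isMaximal_of_surjective (Ideal.Quotient.mk J) Ideal.Quotient.mk_surjective
    (K := P.map (Ideal.Quotient.mk J))
  rw [Ideal.comap_map_of_surjective _ Ideal.Quotient.mk_surjective] at this
  have h2 : P ⊔ Ideal.comap (Ideal.Quotient.mk J) ⊥ = P := by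
    rw [sup_eq_left]; simpa [← RingHom.ker_eq_comap_bot] using hJP
  rw [h2] at this
  exact (eq_maximalIdeal this).ge

theorem length_le_of_isWeaklyRegular [IsLocalRing A] [IsNoetherianRing A] {d : ℕ}
    (hd : ringKrullDim A = d) {xs : List A} (h : IsWeaklyRegular A xs)
    (hm : ∀ x ∈ xs, x ∈ maximalIdeal A) :
    ringKrullDim (A ⧸ Ideal.ofList xs) + xs.length = d ∧ xs.length ≤ d := by
  have h1 := (isRegular_iff_isWeaklyRegular_of_subset_maximalIdeal hm).2 h
  have h2 := ringKrullDim_add_length_eq_ringKrullDim_of_isRegular xs h1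
  rw [hd] at h2
  refine ⟨h2, ?_⟩
  have : Nontrivial (A ⧸ Ideal.ofList xs) := Ideal.Quotient.nontrivial_iff.2
    (ne_top_of_le_ne_top (maximalIdeal.isMaximal A).ne_top (Ideal.span_le.2 fun x hx => hm x hx))
  have h3 : (0 : WithBot ℕ∞) ≤ ringKrullDim (A ⧸ Ideal.ofList xs) := ringKrullDim_nonneg_of_nontrivial
  have h4 : ((xs.length : ℕ) : WithBot ℕ∞) ≤ (d : ℕ) := by
    rw [← h2]
    exact le_add_of_nonneg_left h3
  exact_mod_cast h4

/-- Vanishing of Ext^i(N, A) below the grade gives the sequence `xs` inside ann N, with length equal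
to pd N. Vanishing of Ext^i(k, A) for i < d, which is the Cohen–Macaulay hypothesis, then allows an
extension `post` inside 𝔪 up to total length d. -/
theorem exists_isWeaklyRegular_of_isPerfect [IsLocalRing A] [IsNoetherianRing A]
    (hCM : IsCohenMacaulayLocal A) {d : ℕ} (hd : ringKrullDim A = d)
    {N : Type u} [AddCommGroup N] [Module A N] (hN : IsPerfect A N) :
    ∃ xs post : List A, (∀ x ∈ xs, x ∈ Module.annihilator A N) ∧
      IsWeaklyRegular A (xs ++ post) ∧ (∀ x ∈ xs ++ post, x ∈ maximalIdeal A) ∧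
      (∃ t, maximalIdeal A ^ t ≤ Ideal.ofList (xs ++ post)) ∧ (xs ++ post).length = d ∧
      HasProjectiveDimensionLE (ModuleCat.of A N) xs.length := by
  have := hN.finite
  have := hN.nontrivial
  have hann : Module.annihilator A N ≤ maximalIdeal A := le_maximalIdeal fun h => by
    rw [Module.annihilator_eq_top_iff] at h
    exact not_subsingleton N h
  have key : ∀ n : ℕ, (∀ i < n, Subsingleton (Ext (ModuleCat.of A N) (ModuleCat.of A A) i)) →
      ∃ xs : List A, xs.length = n ∧ (∀ x ∈ xs, x ∈ Module.annihilator A N) ∧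
        IsWeaklyRegular A xs := by
    intro n hn
    obtain ⟨xs, h1, h2, h3⟩ := ModuleCat.exists_isRegular_of_exists_subsingleton_ext
      (Module.annihilator A N) n (ModuleCat.of A A) (by
        rw [smul_eq_mul, Ideal.mul_top]
        exact lt_of_le_of_lt hann (maximalIdeal.isMaximal A).ne_top.lt_top)
      (ModuleCat.of A N) (Module.support_eq_zeroLocus) hn
    exact ⟨xs, h1, h2, h3.toIsWeaklyRegular⟩
  have hlt : ∀ i : ℕ, (i : ℕ∞) < grade A N →
      Subsingleton (Ext (ModuleCat.of A N) (ModuleCat.of A A) i) := by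
    intro i hi
    by_contra hcon
    rw [not_subsingleton_iff_nontrivial] at hcon
    exact absurd (iInf₂_le i hcon) (not_le.2 hi)
  -- An infinite grade would yield a regular sequence of length d + 1, more than the dimension of A.
  have hgrade : grade A N ≠ ⊤ := by
    intro htop
    obtain ⟨xs, h1, h2, h3⟩ := key (d + 1) fun i _ => hlt i (by rw [htop]; exact ENat.natCast_lt_top i)
    have := (length_le_of_isWeaklyRegular hd h3 fun x hx => hann (h2 x hx)).2
    omega
  obtain ⟨s, hs⟩ := ENat.ne_top_iff_exists.1 hgrade
  obtain ⟨xs, h1, h2, h3⟩ := key s fun i hi => hlt i (by rw [← hs]; exact_mod_cast hi)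
  have hxm : ∀ x ∈ xs, x ∈ maximalIdeal A := fun x hx => hann (h2 x hx)
  have hsd := (length_le_of_isWeaklyRegular hd h3 hxm).2
  obtain ⟨rs, hrs, hrsm, hrsl⟩ := hCM
  rw [hd] at hrsl
  have hrsl' : rs.length = d := by exact_mod_cast hrsl
  have hk : ∀ i < d, Subsingleton (Ext (ModuleCat.of A (ResidueField A)) (ModuleCat.of A A) i) := by
    rw [← hrsl']
    refine ModuleCat.subsingleton_ext_of_exists_isRegular (maximalIdeal A) _ ?_ _ ?_ rs hrsm hrs
    · refine (Module.support_eq_zeroLocus).subset.trans ?_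
      refine PrimeSpectrum.zeroLocus_anti_mono ?_
      exact (Ideal.annihilator_quotient (I := maximalIdeal A)).ge
    · rw [smul_eq_mul, Ideal.mul_top]
      exact (maximalIdeal.isMaximal A).ne_top.lt_top
  have htop : Ideal.ofList xs • (⊤ : Submodule A A) = Ideal.ofList xs := by simp
  obtain ⟨post, hp1, hp2, hp3⟩ := ModuleCat.exists_isRegular_of_exists_subsingleton_ext
      (maximalIdeal A) (d - s) (ModuleCat.of A (A ⧸ Ideal.ofList xs • (⊤ : Submodule A A))) (by
        have : Nontrivial (A ⧸ Ideal.ofList xs • (⊤ : Submodule A A)) := by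
          rw [htop]
          exact Ideal.Quotient.nontrivial_iff.2 (ne_top_of_le_ne_top
            (maximalIdeal.isMaximal A).ne_top (Ideal.span_le.2 fun x hx => hxm x hx))
        refine lt_top_iff_ne_top.2 fun h => ?_
        exact top_ne_bot ((Submodule.eq_bot_of_le_smul_of_le_jacobson_bot _ _
          (Module.Finite.fg_top) h.ge (maximalIdeal_le_jacobson ⊥))))
      (ModuleCat.of A (ResidueField A)) (by
        refine (Module.support_eq_zeroLocus).trans ?_
        congr 2
        exact Ideal.annihilator_quotient (I := maximalIdeal A))
      (subsingleton_ext_quotient_of_isWeaklyRegular _ xs A h3 _ fun i hi => hk i (by omega))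
  have hreg : IsWeaklyRegular A (xs ++ post) :=
    (isWeaklyRegular_append_iff A xs post).2 ⟨h3, hp3.toIsWeaklyRegular⟩
  have hm : ∀ x ∈ xs ++ post, x ∈ maximalIdeal A := fun x hx => by
    rcases List.mem_append.1 hx with hx | hx
    · exact hxm x hx
    · exact hp2 x hx
  have hlen : (xs ++ post).length = d := by
    rw [List.length_append, hp1, h1]; omega
  refine ⟨xs, post, h2, hreg, hm, ?_, hlen, ?_⟩
  -- The quotient has dimension d - d = 0; the case split is needed because cancellation is not
  -- available for infinite values.
  · refine exists_pow_maximalIdeal_le _ ?_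
    have := (length_le_of_isWeaklyRegular hd hreg hm).1
    rw [hlen] at this
    generalize ringKrullDim (A ⧸ Ideal.ofList (xs ++ post)) = r at this
    cases r with
    | bot => exact bot_le
    | coe r =>
      cases r with
      | top => 
        exact absurd this (by exact_mod_cast (by simp))
      | coe r =>
        have : r + d = d := by exact_mod_cast this
        have : r = 0 := by omega
        subst this
        exact le_rfl
  · rw [← projectiveDimension_le_iff, hN.projectiveDimension_eq, ← hs, h1]
    exact le_rfl

/-- The classes of `Ext^{d+1}(N ⧸ U, M)`, for `N ⧸ U` of finite length, all come from homomorphisms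
from `U` to a fixed module `K` with finite socle all of whose elements are torsion. -/
theorem exists_torsion_module_hom_ext_surjective [IsLocalRing A] [IsNoetherianRing A]
    (hCM : IsCohenMacaulayLocal A) {d : ℕ} (hd : ringKrullDim A = d)
    {N : Type u} [AddCommGroup N] [Module A N] (hN : IsPerfect A N)
    (M : Type u) [AddCommGroup M] [Module A M] [Module.Finite A M] :
    ∃ (K : Type u) (_ : AddCommGroup K) (_ : Module A K)
      (κ : Ext (ModuleCat.of A K) (ModuleCat.of A M) d),
      (∀ x : K, ∃ n, ∀ a ∈ maximalIdeal A ^ n, a • x = 0) ∧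
      Module.Finite A (Submodule.torsionBySet A K (maximalIdeal A)) ∧
      ∀ (U : Submodule A N) (t : ℕ), (∀ a ∈ maximalIdeal A ^ t, ∀ x, a • x ∈ U) →
        ∀ e : Ext (ModuleCat.of A (N ⧸ U)) (ModuleCat.of A M) (d + 1), ∃ g : U →ₗ[A] K,
          ((submodule_shortExact U).extClass.comp (Ext.mk₀ (ModuleCat.ofHom g)) (add_zero 1)).comp κ
            (add_comm 1 d) = e := by
  have : IsSimpleModule A (ResidueField A) :=
    isSimpleModule_iff_quot_maximal.2 ⟨_, maximalIdeal.isMaximal A, ⟨LinearEquiv.refl A _⟩⟩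
  have hfinN := hN.finite
  have : Module.Finite A (ResidueField A) := inferInstance
  obtain ⟨C, _, _, κ, hfin, hκ⟩ := exists_cosyzygy (ResidueField A) M
    (fun i => ModuleCat.finite_ext A (ModuleCat.of A (ResidueField A)) (ModuleCat.of A M) i) d
  obtain ⟨xs, post, hann, hreg, hm, hrad, hlen, hpd⟩ :=
    exists_isWeaklyRegular_of_isPerfect hCM hd hN
  have hC : ∀ ys, IsPowList (xs ++ post) ys →
      Subsingleton (Ext (ModuleCat.of A (A ⧸ Ideal.ofList ys)) (ModuleCat.of A C) 1) := by
    intro ys hys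
    have hym : ∀ y ∈ ys, y ∈ maximalIdeal A := by
      intro y hy
      obtain ⟨x, hx, a, rfl⟩ : ∃ x ∈ xs ++ post, ∃ a : ℕ, y = x ^ (a + 1) := by
        obtain ⟨i, hi, rfl⟩ := List.getElem_of_mem hy
        have hi' : i < (xs ++ post).length := by rwa [hys.length_eq]
        exact ⟨(xs ++ post)[i], List.getElem_mem hi', hys.get hi' hi⟩
      exact Ideal.pow_mem_of_mem _ (hm x hx) _ (Nat.succ_pos a)
    -- A/(ys) has projective dimension d, and the shift by `κ` carries the vanishing in degree d + 1
    -- to degree 1 on C.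
    have : Subsingleton (Ext (ModuleCat.of A (A ⧸ Ideal.ofList ys)) (ModuleCat.of A M) (d + 1)) :=
      subsingleton_ext_quotient_ofList
      (isWeaklyRegular_append_pow hys [] hreg hm) hym (ModuleCat.of A M) (d + 1)
      (by rw [← hlen, hys.length_eq]; exact Nat.lt_succ_self _)
    exact (hκ (ModuleCat.of A (A ⧸ Ideal.ofList ys)) 0 (d + 1) (by omega)).1.subsingleton
  have hcor : IsCoregular xs (killedBy (powTorsion (maximalIdeal A) C) []) :=
    isCoregular_powTorsion [] xs post hreg hm hrad hC
  have hk0 : killedBy (powTorsion (maximalIdeal A) C) [] = powTorsion (maximalIdeal A) C := by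
    ext c
    exact ⟨fun h => h.1, fun h => ⟨h, by simp⟩⟩
  rw [hk0] at hcor
  have hNK : Subsingleton (Ext (ModuleCat.of A N)
      (ModuleCat.of A (powTorsion (maximalIdeal A) C)) 1) :=
    subsingleton_ext_of_isCoregular N xs hann _ hcor 1 fun X =>
      HasProjectiveDimensionLT.subsingleton _ (xs.length + 1) _ (by omega) X
  refine ⟨powTorsion (maximalIdeal A) C, inferInstance, inferInstance,
    (Ext.mk₀ (ModuleCat.ofHom (powTorsion (maximalIdeal A) C).subtype)).comp κ (zero_add d), ?_, ?_, ?_⟩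
  · rintro ⟨x, n, hn⟩
    exact ⟨n, fun a ha => Subtype.ext (hn a ha)⟩
  · have h0 := hfin 0
    have hk : ∀ (x : Submodule.torsionBySet A (powTorsion (maximalIdeal A) C) (maximalIdeal A)),
        ∀ a ∈ maximalIdeal A, a • ((x : powTorsion (maximalIdeal A) C) : C) = 0 := by
      rintro ⟨x, hx⟩ a ha
      exact congrArg Subtype.val ((Submodule.mem_torsionBySet_iff _ _).1 hx ⟨a, ha⟩)
    -- The socle of K embeds in Hom(k, C), which is finite by the construction of C.
    let F : Submodule.torsionBySet A (powTorsion (maximalIdeal A) C) (maximalIdeal A) →ₗ[A]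
        (ResidueField A →ₗ[A] C) :=
      { toFun := fun x => quotLift (maximalIdeal A) _ (hk x)
        map_add' := fun x y => by
          refine LinearMap.ext fun a => ?_
          obtain ⟨a, rfl⟩ := Submodule.Quotient.mk_surjective _ a
          exact smul_add a _ _
        map_smul' := fun r x => by
          refine LinearMap.ext fun a => ?_
          obtain ⟨a, rfl⟩ := Submodule.Quotient.mk_surjective _ a
          exact smul_comm a r _ }
    let e : Ext (ModuleCat.of A (ResidueField A)) (ModuleCat.of A C) 0 ≃ₗ[A] (ResidueField A →ₗ[A] C) :=
      (Ext.linearEquiv₀ (R := A)).trans (ModuleCat.homLinearEquiv (S := A))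
    have h1 : Module.Finite A (ResidueField A →ₗ[A] C) := Module.Finite.equiv e
    have := isNoetherian_of_isNoetherianRing_of_finite A (ResidueField A →ₗ[A] C)
    refine Module.Finite.of_injective F fun x y hxy => ?_
    have h2 : (1 : A) • ((x : powTorsion (maximalIdeal A) C) : C) =
        (1 : A) • ((y : powTorsion (maximalIdeal A) C) : C) :=
      LinearMap.congr_fun hxy (Submodule.Quotient.mk 1)
    rw [one_smul, one_smul] at h2
    exact Subtype.ext (Subtype.ext h2)
  · intro U t ht e
    obtain ⟨e₁, he₁⟩ := (hκ (ModuleCat.of A (N ⧸ U)) 0 (d + 1) (by omega)).2 e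
    obtain ⟨g, hg⟩ := exists_hom_extClass_eq U (maximalIdeal A) (by
      intro x
      have hpow : IsPowList (xs ++ post) ((xs ++ post).map (· ^ (t + 1))) := by
        rw [IsPowList, List.forall₂_map_right_iff]
        exact List.forall₂_same.2 fun x _ => ⟨t, rfl⟩
      -- The exponent t + 1 is positive, as `IsPowList` requires, and puts the ideal inside 𝔪^t,
      -- which carries N into U.
      refine ⟨Ideal.ofList ((xs ++ post).map (· ^ (t + 1))), ?_, ?_, hC _ hpow⟩
      · intro a ha
        refine ht a ((Ideal.span_le.2 fun y hy => ?_ : Ideal.ofList _ ≤ _) ha) x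
        obtain ⟨z, hz, rfl⟩ := List.mem_map.1 hy
        exact Ideal.pow_le_pow_right (Nat.le_succ t) (Ideal.pow_mem_pow (hm z hz) _)
      · obtain ⟨t', ht'⟩ := hrad
        have hle : Ideal.ofList (xs ++ post) ≤
            (Ideal.ofList ((xs ++ post).map (· ^ (t + 1)))).radical :=
          Ideal.span_le.2 fun y hy => ⟨t + 1, Ideal.subset_span (List.mem_map.2 ⟨y, hy, rfl⟩)⟩
        obtain ⟨s, hs⟩ := Ideal.exists_pow_le_of_le_radical_of_fg hle (IsNoetherian.noetherian _)
        exact ⟨t' * s, by rw [pow_mul]; exact (Ideal.pow_right_mono ht' s).trans hs⟩) e₁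
    refine ⟨g, ?_⟩
    rw [← he₁, ← hg]
    rw [ModuleCat.ofHom_comp]
    change _ = Ext.comp (Ext.comp _ _ (add_zero 1)) κ (add_comm 1 d)
    rw [Ext.comp_assoc_of_second_deg_zero, Ext.comp_assoc_of_second_deg_zero, Ext.mk₀_comp_mk₀_assoc]

end

/-! ### Matlis duality, and finite length of the Ext modules. -/

section

open IsLocalRing

theorem isPrecomplete_pi (I : Ideal A) [IsPrecomplete I A] (n : ℕ) :
    IsPrecomplete I (Fin n → A) := by
  have hmem : ∀ (m : ℕ) (x : Fin n → A), x ∈ (I ^ m • ⊤ : Submodule A (Fin n → A)) ↔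
      ∀ i, x i ∈ (I ^ m • ⊤ : Submodule A A) := by
    intro m x
    constructor
    · intro hx i
      have := Submodule.mem_map_of_mem (f := LinearMap.proj i) hx
      rw [Submodule.map_smul''] at this
      exact Submodule.smul_mono le_rfl le_top this
    · intro hx
      rw [pi_eq_sum_univ' x]
      refine Submodule.sum_mem _ fun i _ => Submodule.smul_mem_smul ?_ Submodule.mem_top
      simpa using hx i
  refine ⟨fun f hf => ?_⟩
  have h := fun i => IsPrecomplete.prec (I := I) (M := A) inferInstance (f := fun m => f m i)
    (fun {m k} hmk => by
      rw [SModEq.sub_mem]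
      exact (hmem m _).1 (SModEq.sub_mem.1 (hf hmk)) i)
  choose L hL using h
  exact ⟨L, fun m => SModEq.sub_mem.2 ((hmem m _).2 fun i => SModEq.sub_mem.1 (hL i m))⟩

/-- A nonzero socle element has, by essentiality, a nonzero multiple in the copy of k; the
multiplier does not lie in 𝔪, hence is a unit. -/
theorem torsionBySet_le_range [IsLocalRing A] {E : Type u} [AddCommGroup E] [Module A E]
    (ι : ResidueField A →ₗ[A] E)
    (hess : ∀ S : Submodule A E, S ≠ ⊥ → S ⊓ LinearMap.range ι ≠ ⊥) :
    Submodule.torsionBySet A E (maximalIdeal A) ≤ LinearMap.range ι := by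
  intro x hx
  by_cases hx0 : x = 0
  · rw [hx0]; exact zero_mem _
  have h := hess (Submodule.span A {x}) (by simpa using hx0)
  obtain ⟨y, ⟨hy1, hy2⟩, hy0⟩ := (Submodule.ne_bot_iff _).1 h
  obtain ⟨r, rfl⟩ := Submodule.mem_span_singleton.1 hy1
  have hr : r ∉ maximalIdeal A := fun hr =>
    hy0 ((Submodule.mem_torsionBySet_iff _ _).1 hx ⟨r, hr⟩)
  rw [mem_maximalIdeal, mem_nonunits_iff, not_not] at hr
  obtain ⟨r, rfl⟩ := hr
  have := (LinearMap.range ι).smul_mem (↑r⁻¹ : A) hy2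
  rwa [smul_smul, Units.inv_mul, one_smul] at this

theorem finite_linearMap [IsNoetherianRing A] (X Y : Type u) [AddCommGroup X] [Module A X]
    [AddCommGroup Y] [Module A Y] [Module.Finite A X] [Module.Finite A Y] :
    Module.Finite A (X →ₗ[A] Y) := by
  have := ModuleCat.finite_ext A (ModuleCat.of A X) (ModuleCat.of A Y) 0
  let e : Ext (ModuleCat.of A X) (ModuleCat.of A Y) 0 ≃ₗ[A] (X →ₗ[A] Y) :=
    (Ext.linearEquiv₀ (R := A)).trans (ModuleCat.homLinearEquiv (S := A))
  exact Module.Finite.equiv e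

/-- The dual of a torsion module with finite socle over a complete local ring is finite. -/
theorem finite_dual [IsLocalRing A] [IsNoetherianRing A] [IsAdicComplete (maximalIdeal A) A]
    {E : Type u} [AddCommGroup E] [Module A E] (hE : IsResidueFieldInjectiveHull A E)
    (K : Type u) [AddCommGroup K] [Module A K]
    (htors : ∀ x : K, ∃ n, ∀ a ∈ maximalIdeal A ^ n, a • x = 0)
    [Module.Finite A (Submodule.torsionBySet A K (maximalIdeal A))] :
    Module.Finite A (K →ₗ[A] E) := by
  have := hE.injective
  obtain ⟨ι, hι, hess⟩ := hE.exists_essential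
  let S := Submodule.torsionBySet A K (maximalIdeal A)
  let T := Submodule.torsionBySet A E (maximalIdeal A)
  have hTfin : Module.Finite A T := by
    have := isNoetherian_of_isNoetherianRing_of_finite A (LinearMap.range ι)
    exact Module.Finite.of_injective (Submodule.inclusion (torsionBySet_le_range ι hess))
      (Submodule.inclusion_injective _)
  have hST := finite_linearMap (A := A) S T
  have hres : ∀ (q : K →ₗ[A] E) (x : S), q x ∈ T := by
    rintro q ⟨x, hx⟩
    refine (Submodule.mem_torsionBySet_iff _ _).2 fun a => ?_
    rw [← map_smul]
    exact (congrArg q ((Submodule.mem_torsionBySet_iff _ _).1 hx a)).trans (map_zero q)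
  let F : (K →ₗ[A] E) →ₗ[A] (S →ₗ[A] T) :=
    { toFun := fun q => LinearMap.codRestrict T (q ∘ₗ S.subtype) (hres q)
      map_add' := fun _ _ => rfl
      map_smul' := fun _ _ => rfl }
  -- With y₁, …, y_r generating 𝔪, the socle is the kernel of G = (y₁, …, y_r) : K → K^r. A
  -- functional q vanishing on it factors through the image of G and extends to K^r by injectivity
  -- of E, so q = ∑ y_i h_i lies in 𝔪 K^∨.
  have hker : LinearMap.ker F ≤ maximalIdeal A • (⊤ : Submodule A (K →ₗ[A] E)) := by
    intro q hq
    obtain ⟨r, y, hy⟩ := Submodule.fg_iff_exists_fin_generating_family.1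
      (IsNoetherian.noetherian (maximalIdeal A))
    have hym : ∀ i, y i ∈ maximalIdeal A := fun i => by
      rw [← hy]; exact Submodule.subset_span ⟨i, rfl⟩
    let G : K →ₗ[A] (Fin r → K) := LinearMap.pi fun i => y i • LinearMap.id
    have hG : LinearMap.ker G = S := by
      ext x
      constructor
      · intro hx
        refine (Submodule.mem_torsionBySet_iff _ _).2 fun a => ?_
        have : maximalIdeal A ≤ LinearMap.ker (LinearMap.toSpanSingleton A K x) := by
          rw [← hy, Submodule.span_le]
          rintro _ ⟨i, rfl⟩
          exact congrFun hx i
        exact this a.2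
      · intro hx
        funext i
        exact (Submodule.mem_torsionBySet_iff _ _).1 hx ⟨y i, hym i⟩
    obtain ⟨h, hh⟩ := Module.Injective.extension_property A (M := E) _ _
      ((LinearMap.ker G).liftQ G le_rfl)
      (LinearMap.ker_eq_bot.1 (Submodule.ker_liftQ_eq_bot _ _ _ le_rfl))
      ((LinearMap.ker G).liftQ q (fun x hx => by
        rw [hG] at hx
        exact congrArg Subtype.val (LinearMap.congr_fun hq ⟨x, hx⟩)))
    have hq2 : q = ∑ i, y i • (h ∘ₗ LinearMap.single A (fun _ => K) i) := by
      refine LinearMap.ext fun x => ?_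
      have h1 : h (G x) = q x := LinearMap.congr_fun hh (Submodule.Quotient.mk x)
      rw [← h1]
      have h2 : G x = ∑ i, y i • LinearMap.single A (fun _ => K) i x := by
        funext j
        simp [G, Finset.sum_apply, Pi.single_apply]
      rw [h2, map_sum]
      simp
    rw [hq2]
    exact Submodule.sum_mem _ fun i _ => Submodule.smul_mem_smul (hym i) Submodule.mem_top
  have hfr : Module.Finite A (LinearMap.range F) := by
    have := isNoetherian_of_isNoetherianRing_of_finite A (S →ₗ[A] T)
    infer_instance
  obtain ⟨n, s, hs⟩ := Module.Finite.exists_fin (R := A) (M := LinearMap.range F)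
  choose q hq using fun i => (s i).2
  have hpre := isPrecomplete_pi (maximalIdeal A) n
  -- Every element of K is killed by a power of 𝔪, so K^∨ is 𝔪-adically separated. It is finite
  -- modulo 𝔪, and completeness of A then lifts generators.
  have hhaus : IsHausdorff (maximalIdeal A) (K →ₗ[A] E) := by
    refine ⟨fun f hf => LinearMap.ext fun x => ?_⟩
    obtain ⟨n, hn⟩ := htors x
    have h1 := SModEq.zero.1 (hf n)
    have h2 : (maximalIdeal A ^ n • ⊤ : Submodule A (K →ₗ[A] E)) ≤
        LinearMap.ker (LinearMap.applyₗ (R := A) (M₂ := E) x) := by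
      rw [Submodule.smul_le]
      intro a ha g _
      change a • g x = 0
      rw [← map_smul, hn a ha, map_zero]
    exact h2 h1
  have hsurj := surjective_of_mkQ_comp_surjective (I := maximalIdeal A)
    (f := Fintype.linearCombination A q) (by
      intro z
      obtain ⟨p, rfl⟩ := Submodule.mkQ_surjective _ z
      have hp : (⟨F p, p, rfl⟩ : LinearMap.range F) ∈ Submodule.span A (Set.range s) :=
        hs ▸ Submodule.mem_top
      obtain ⟨c, hc⟩ := (Submodule.mem_span_range_iff_exists_fun A).1 hp
      refine ⟨c, ?_⟩
      refine (Submodule.Quotient.eq _).2 (hker ?_)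
      rw [LinearMap.sub_mem_ker_iff, Fintype.linearCombination_apply, map_sum]
      simp only [map_smul, hq]
      have := congrArg Subtype.val hc
      simpa using this)
  exact Module.Finite.of_surjective _ hsurj

theorem length_dual_residueField [IsLocalRing A] {E : Type u} [AddCommGroup E] [Module A E]
    (hE : IsResidueFieldInjectiveHull A E) :
    Module.length A (ResidueField A →ₗ[A] E) = Module.length A (ResidueField A) := by
  obtain ⟨ι, hι, hess⟩ := hE.exists_essential
  have : IsSimpleModule A (ResidueField A) :=
    isSimpleModule_iff_quot_maximal.2 ⟨_, maximalIdeal.isMaximal A, ⟨LinearEquiv.refl A _⟩⟩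
  let F : ResidueField A →ₗ[A] (ResidueField A →ₗ[A] E) :=
    { toFun := fun c => ι ∘ₗ LinearMap.mulLeft A c
      map_add' := fun c d => by ext x; simp [add_mul]
      map_smul' := fun r c => by ext x; simp }
  refine (LinearEquiv.ofBijective F ⟨fun c d h => ?_, fun f => ?_⟩).length_eq.symm
  · have := LinearMap.congr_fun h 1
    simpa [F] using hι this
  · have hf := range_le_of_essential ι (fun S => not_imp_not.1 (hess S)) f
    obtain ⟨c, hc⟩ := hf ⟨1, rfl⟩
    refine ⟨c, LinearMap.ext fun x => ?_⟩
    obtain ⟨x, rfl⟩ := Submodule.Quotient.mk_surjective _ x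
    have h1 : (Submodule.Quotient.mk x : ResidueField A) = x • (1 : ResidueField A) := by
      rw [Algebra.smul_def, mul_one]; rfl
    rw [h1, map_smul, map_smul, ← hc]
    simp [F]

/-- Dualising into the injective E is exact and sends k to a module of the same length, so length is
preserved along a composition series. -/
theorem length_dual [IsLocalRing A] {E : Type u} [AddCommGroup E] [Module A E]
    (hE : IsResidueFieldInjectiveHull A E) {X : Type u} [AddCommGroup X] [Module A X]
    (hX : IsFiniteLength A X) : Module.length A (X →ₗ[A] E) = Module.length A X := by
  have := hE.injective
  induction hX with
  | of_subsingleton =>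
    rw [Module.length_eq_zero, Module.length_eq_zero]
  | @of_simple_quotient X _ _ Y hsimple _ ih =>
    rw [Module.length_eq_add_of_exact Y.subtype Y.mkQ Y.injective_subtype Y.mkQ_surjective
      (LinearMap.exact_subtype_mkQ Y),
      Module.length_eq_add_of_exact (LinearMap.lcomp A E Y.mkQ) (LinearMap.lcomp A E Y.subtype)
      ?_ ?_ ?_, ih, add_comm]
    · congr 1
      obtain ⟨m, hm, ⟨e⟩⟩ := isSimpleModule_iff_quot_maximal.1 hsimple
      obtain rfl := eq_maximalIdeal hm
      rw [e.length_eq, (e.arrowCongr (LinearEquiv.refl A E)).length_eq]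
      exact length_dual_residueField hE
    · intro f g h
      refine LinearMap.ext fun x => ?_
      obtain ⟨x, rfl⟩ := Y.mkQ_surjective x
      exact LinearMap.congr_fun h x
    · intro f
      exact Module.Injective.extension_property A (M := E) _ _ Y.subtype Y.injective_subtype f
    · intro f
      constructor
      · intro hf
        have hle : Y ≤ LinearMap.ker f := fun x hx => LinearMap.congr_fun hf ⟨x, hx⟩
        exact ⟨Y.liftQ f hle, Y.liftQ_mkQ f hle⟩
      · rintro ⟨g, rfl⟩
        refine LinearMap.ext fun x => ?_
        change g (Y.mkQ x) = 0
        rw [Submodule.mkQ_apply, (Submodule.Quotient.mk_eq_zero Y).2 x.2, map_zero]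

theorem length_ne_top_of_exact {X Y Z : Type*} [AddCommGroup X] [Module A X]
    [AddCommGroup Y] [Module A Y] [AddCommGroup Z] [Module A Z] (f : X →ₗ[A] Y) (g : Y →ₗ[A] Z)
    (h : Function.Exact f g) (hf : Function.Injective f) (hg : Function.Surjective g)
    (hX : Module.length A X ≠ ⊤) (hZ : Module.length A Z ≠ ⊤) : Module.length A Y ≠ ⊤ := by
  rw [Module.length_eq_add_of_exact f g hf hg h]
  exact WithTop.add_ne_top.2 ⟨hX, hZ⟩

/-- A finite module killed by a power of the maximal ideal has finite length. -/
theorem length_ne_top_of_pow_smul_eq_zero [IsLocalRing A] [IsNoetherianRing A] (t : ℕ) (X : Type*)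
    [AddCommGroup X] [Module A X] [Module.Finite A X]
    (h : ∀ a ∈ maximalIdeal A ^ t, ∀ x : X, a • x = 0) : Module.length A X ≠ ⊤ := by
  induction t generalizing X with
  | zero =>
    have : Subsingleton X := ⟨fun x y => by
      rw [← one_smul A x, ← one_smul A y, h 1 (by simp), h 1 (by simp)]⟩
    rw [Module.length_eq_zero]
    simp
  | succ t ih =>
    have := isNoetherian_of_isNoetherianRing_of_finite A X
    let Y : Submodule A X := maximalIdeal A ^ t • ⊤
    refine length_ne_top_of_exact Y.subtype Y.mkQ (LinearMap.exact_subtype_mkQ Y)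
      Y.injective_subtype Y.mkQ_surjective ?_ (ih _ fun a ha x => ?_)
    · have hY : ∀ a ∈ maximalIdeal A, ∀ y ∈ Y, a • y = 0 := by
        intro a ha y hy
        refine Submodule.smul_induction_on hy (fun b hb x _ => ?_) fun x z hx hz => ?_
        · rw [smul_smul]
          exact h _ (by rw [pow_succ']; exact Ideal.mul_mem_mul ha hb) x
        · rw [smul_add, hx, hz, add_zero]
      obtain ⟨n, s, hs⟩ := Module.Finite.exists_fin (R := A) (M := Y)
      have hk : ∀ i, ∀ a ∈ maximalIdeal A, a • s i = 0 := fun i a ha =>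
        Subtype.ext (hY a ha _ (s i).2)
      let F : (Fin n → A ⧸ maximalIdeal A) →ₗ[A] Y :=
        ∑ i, ((maximalIdeal A).liftQ (LinearMap.toSpanSingleton A Y (s i)) fun a ha =>
          hk i a ha) ∘ₗ LinearMap.proj i
      have hF : Function.Surjective F := by
        intro y
        have hy : y ∈ Submodule.span A (Set.range s) := hs ▸ Submodule.mem_top
        obtain ⟨c, hc⟩ := (Submodule.mem_span_range_iff_exists_fun A).1 hy
        refine ⟨fun i => Submodule.Quotient.mk (c i), ?_⟩
        rw [← hc, LinearMap.sum_apply]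
        rfl
      have hsimple : IsSimpleModule A (A ⧸ maximalIdeal A) :=
        isSimpleModule_iff_quot_maximal.2 ⟨_, maximalIdeal.isMaximal A, ⟨LinearEquiv.refl A _⟩⟩
      refine ne_top_of_le_ne_top ?_ (Module.length_le_of_surjective F hF)
      rw [Module.length_pi_of_fintype]
      simp [Module.length_eq_one]
    · obtain ⟨x, rfl⟩ := Y.mkQ_surjective x
      exact (Submodule.Quotient.mk_eq_zero Y).2 (Submodule.smul_mem_smul ha Submodule.mem_top)

theorem exists_pow_smul_eq_zero [IsLocalRing A] {X : Type*} [AddCommGroup X] [Module A X]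
    (hX : IsFiniteLength A X) : ∃ t, ∀ a ∈ maximalIdeal A ^ t, ∀ x : X, a • x = 0 := by
  induction hX with
  | of_subsingleton => exact ⟨0, fun _ _ _ => Subsingleton.elim _ _⟩
  | @of_simple_quotient X _ _ Y hsimple _ ih =>
    obtain ⟨t, ht⟩ := ih
    refine ⟨t + 1, fun a ha x => ?_⟩
    obtain ⟨m, hm, ⟨e⟩⟩ := isSimpleModule_iff_quot_maximal.1 hsimple
    obtain rfl := eq_maximalIdeal hm
    have hY : ∀ b ∈ maximalIdeal A, b • x ∈ Y := by
      intro b hb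
      rw [← Submodule.Quotient.mk_eq_zero, Submodule.Quotient.mk_smul]
      refine e.injective ?_
      rw [map_smul, map_zero]
      generalize e (Submodule.Quotient.mk x) = z
      obtain ⟨z, rfl⟩ := Submodule.Quotient.mk_surjective _ z
      exact (Submodule.Quotient.mk_eq_zero _).2 (Ideal.mul_mem_right z _ hb)
    rw [pow_succ] at ha
    refine Submodule.mul_induction_on ha (fun b hb c hc => ?_) fun b c hb hc => ?_
    · rw [mul_smul]
      exact congrArg Subtype.val (ht b hb ⟨c • x, hY c hc⟩)
    · rw [add_smul, hb, hc, add_zero]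

/-- If `N ⧸ I N` has finite length, each `N ⧸ I ^ n N` is killed by a power of the maximal ideal. -/
theorem exists_pow_smul_mem_pow_smul [IsLocalRing A] {I : Ideal A} {N : Type*} [AddCommGroup N]
    [Module A N] (hIN : IsFiniteLength A (N ⧸ (I • (⊤ : Submodule A N)))) (n : ℕ) :
    ∃ t, ∀ a ∈ maximalIdeal A ^ t, ∀ x : N, a • x ∈ I ^ n • (⊤ : Submodule A N) := by
  obtain ⟨t, ht⟩ := exists_pow_smul_eq_zero hIN
  have h1 : maximalIdeal A ^ t • (⊤ : Submodule A N) ≤ I • ⊤ := by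
    rw [Submodule.smul_le]
    exact fun a ha x _ => (Submodule.Quotient.mk_eq_zero _).1 (ht a ha (Submodule.Quotient.mk x))
  have h2 : ∀ n, (maximalIdeal A ^ t) ^ n • (⊤ : Submodule A N) ≤ I ^ n • ⊤ := by
    intro n
    induction n with
    | zero => simp
    | succ n ih =>
      rw [pow_succ, pow_succ', mul_smul, mul_smul]
      refine (Submodule.smul_mono le_rfl h1).trans ?_
      rw [← mul_smul, mul_comm, mul_smul]
      exact Submodule.smul_mono le_rfl ih
  refine ⟨t * n, fun a ha x => h2 n (Submodule.smul_mem_smul ?_ Submodule.mem_top)⟩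
  rwa [← pow_mul]

theorem extMap_apply {N₁ N₂ M : Type u} [AddCommGroup N₁] [Module A N₁] [AddCommGroup N₂]
    [Module A N₂] [AddCommGroup M] [Module A M] {j : ℕ} (f : N₁ →ₗ[A] N₂)
    (e : Ext (ModuleCat.of A N₂) (ModuleCat.of A M) j) :
    extMap M j f e = (Ext.mk₀ (ModuleCat.ofHom f)).comp e (zero_add j) := rfl

theorem extMap_smul {N₁ N₂ M : Type u} [AddCommGroup N₁] [Module A N₁] [AddCommGroup N₂]
    [Module A N₂] [AddCommGroup M] [Module A M] {j : ℕ} (a : A) (f : N₁ →ₗ[A] N₂) :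
    extMap M j (a • f) = a • extMap M j f := by
  have : ModuleCat.ofHom (a • f) = a • ModuleCat.ofHom f := rfl
  rw [extMap, this, Ext.mk₀_smul, map_smul]; rfl

theorem smul_ext_eq_zero {X M : Type u} [AddCommGroup X] [Module A X] [AddCommGroup M] [Module A M]
    {j : ℕ} {a : A} (h : ∀ x : X, a • x = 0) (e : Ext (ModuleCat.of A X) (ModuleCat.of A M) j) :
    a • e = 0 := by
  have h1 : extMap M j (a • (LinearMap.id : X →ₗ[A] X)) = 0 := by
    have : a • (LinearMap.id : X →ₗ[A] X) = 0 := LinearMap.ext h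
    rw [this]
    ext e
    rw [extMap_apply, ModuleCat.ofHom_zero, Ext.mk₀_zero, Ext.zero_comp]
    rfl
  rw [extMap_smul, extMap_id] at h1
  exact LinearMap.congr_fun h1 e

theorem length_extPart_ne_top [IsLocalRing A] [IsNoetherianRing A] {I : Ideal A} {N : Type u}
    [AddCommGroup N] [Module A N] [Module.Finite A N] {M : Type u} [AddCommGroup M] [Module A M]
    [Module.Finite A M] (hIN : IsFiniteLength A (N ⧸ (I • (⊤ : Submodule A N)))) (j n : ℕ) :
    Module.length A (ExtPart I N M j n) ≠ ⊤ := by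
  obtain ⟨t, ht⟩ := exists_pow_smul_mem_pow_smul hIN (n + 1)
  have := ModuleCat.finite_ext A (ModuleCat.of A (FiltQuot I N n)) (ModuleCat.of A M) j
  refine length_ne_top_of_pow_smul_eq_zero t _ fun a ha e => smul_ext_eq_zero (fun x => ?_) e
  obtain ⟨x, rfl⟩ := Submodule.Quotient.mk_surjective _ x
  exact (Submodule.Quotient.mk_eq_zero _).2 (ht a ha x)

end

/-! ### Components of V(M), and its finite generation over the Rees algebra. -/

section Components

variable (I : Ideal A) (N M E : Type u) [AddCommGroup N] [Module A N] [AddCommGroup M] [Module A M]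
  [AddCommGroup E] [Module A E] (j : ℕ)

/-- The projection of `V(M)` to the component of degree `n`. -/
def proj (n : ℕ) : DualSum I N M E j →ₗ[A] DualPart I N M E j n :=
  DirectSum.component A ℕ (DualPart I N M E j) n

variable {I N M E j}

theorem proj_incl_self (n : ℕ) (v : DualPart I N M E j n) :
    proj I N M E j n (incl I N M E j n v) = v :=
  DirectSum.component.lof_self (R := A) n v

theorem proj_incl_of_ne {m n : ℕ} (h : m ≠ n) (v : DualPart I N M E j m) :
    proj I N M E j n (incl I N M E j m v) = 0 := by
  change DirectSum.component A ℕ (DualPart I N M E j) n (DirectSum.lof A ℕ _ m v) = 0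
  rw [DirectSum.component.of, dif_neg h]

theorem dualSum_ext {v w : DualSum I N M E j} (h : ∀ n, proj I N M E j n v = proj I N M E j n w) :
    v = w :=
  DFinsupp.ext h

theorem dualSum_induction {motive : DualSum I N M E j → Prop} (v : DualSum I N M E j)
    (zero : motive 0) (incl : ∀ n x, motive (incl I N M E j n x))
    (add : ∀ x y, motive x → motive y → motive (x + y)) : motive v :=
  DirectSum.induction_on v zero incl add

theorem proj_smul_add (i n : ℕ) (a : ↥(I ^ i)) (v : DualSum I N M E j) :
    proj I N M E j (n + i) (reesMonomial I i a • v) =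
      act I N M E j rfl a (proj I N M E j n v) := by
  induction v using dualSum_induction with
  | zero => simp
  | add x y hx hy => rw [smul_add, map_add, map_add, map_add, hx, hy]
  | incl m x =>
    rw [reesMonomial_smul_incl]
    by_cases h : m = n
    · subst h
      rw [proj_incl_self, proj_incl_self]
    · rw [proj_incl_of_ne h, proj_incl_of_ne (by omega), map_zero]

theorem proj_smul_of_lt {i n : ℕ} (h : n < i) (a : ↥(I ^ i)) (v : DualSum I N M E j) :
    proj I N M E j n (reesMonomial I i a • v) = 0 := by
  induction v using dualSum_induction with
  | zero => simp
  | add x y hx hy => rw [smul_add, map_add, hx, hy, add_zero]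
  | incl m x => rw [reesMonomial_smul_incl, proj_incl_of_ne (by omega)]

theorem coeffHom_reesMonomial_mul_add (i n : ℕ) (a : ↥(I ^ i)) (f : reesAlgebra I) :
    (coeffHom I (n + i) (reesMonomial I i a * f) : A) = a * coeffHom I n f := by
  change (Polynomial.monomial i (a : A) * (f : Polynomial A)).coeff (n + i) = _
  rw [Polynomial.coeff_monomial_mul]
  rfl

theorem coeffHom_reesMonomial_mul_of_lt {i n : ℕ} (h : n < i) (a : ↥(I ^ i)) (f : reesAlgebra I) :
    coeffHom I n (reesMonomial I i a * f) = 0 := by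
  ext
  change (Polynomial.monomial i (a : A) * (f : Polynomial A)).coeff n = 0
  rw [← Polynomial.C_mul_X_pow_eq_monomial, mul_assoc, Polynomial.coeff_C_mul,
    Polynomial.coeff_X_pow_mul', if_neg (by omega), mul_zero]

theorem coeffHom_reesMonomial_self (n : ℕ) (a : ↥(I ^ n)) :
    coeffHom I n (reesMonomial I n a) = a := by
  ext
  simp [coeffHom, reesMonomial]

theorem coeffHom_reesMonomial_of_ne {m n : ℕ} (h : m ≠ n) (a : ↥(I ^ m)) :
    coeffHom I n (reesMonomial I m a) = 0 := by
  ext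
  simp [coeffHom, reesMonomial, Polynomial.coeff_monomial, h]

/-- Multiplication of `y ∈ I N` by elements of `I ^ n`. -/
def mulMem (n : ℕ) (y : ↥(I • (⊤ : Submodule A N))) :
    ↥(I ^ n) →ₗ[A] ↥(I ^ (n + 1) • (⊤ : Submodule A N)) where
  toFun a := ⟨(a : A) • (y : N), by
    rw [pow_succ, mul_smul]
    exact Submodule.smul_mem_smul a.2 y.2⟩
  map_add' a b := Subtype.ext (add_smul _ _ _)
  map_smul' a b := Subtype.ext (mul_smul _ _ _)

theorem exists_eq_sum_mulMem {p : ℕ} {y : Fin p → ↥(I • (⊤ : Submodule A N))}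
    (hy : Submodule.span A (Set.range y) = ⊤) (n : ℕ) (u : ↥(I ^ (n + 1) • (⊤ : Submodule A N))) :
    ∃ a : Fin p → ↥(I ^ n), u = ∑ i, mulMem n (y i) (a i) := by
  have hspan : I • (⊤ : Submodule A N) = Submodule.span A (Set.range fun i => (y i : N)) := by
    have := congrArg (Submodule.map (Submodule.subtype _)) hy
    rw [Submodule.map_span, Submodule.map_top, Submodule.range_subtype, ← Set.range_comp] at this
    exact this.symm
  obtain ⟨u, hu⟩ := u
  have hu' := hu
  rw [pow_succ, mul_smul, hspan, Submodule.mem_ideal_smul_span_iff_exists_sum] at hu'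
  obtain ⟨a, ha, rfl⟩ := hu'
  refine ⟨fun i => ⟨a i, ha i⟩, Subtype.ext ?_⟩
  rw [AddSubmonoidClass.coe_finsetSum]
  exact Finsupp.sum_fintype a (fun i c => c • (y i : N)) fun _ => zero_smul A _

/-- Multiplication by `a ∈ I ^ i` from `I ^ (n + 1) N` to `I ^ (n + i + 1) N`. -/
def mulSub (i n : ℕ) (a : ↥(I ^ i)) :
    ↥(I ^ (n + 1) • (⊤ : Submodule A N)) →ₗ[A] ↥(I ^ (n + i + 1) • (⊤ : Submodule A N)) :=
  LinearMap.restrict (LinearMap.lsmul A N (a : A)) fun x hx => by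
    rw [show n + i + 1 = i + (n + 1) by omega, pow_add, mul_smul]
    exact Submodule.smul_mem_smul a.2 hx

end Components

/-- The map `Hom(U, K) → Ext^{d+1}(N ⧸ U, M)` given by the class of `U → N → N ⧸ U` and a class
in `Ext^d(K, M)`. -/
def extOfHom {N K M : Type u} [AddCommGroup N] [Module A N] [AddCommGroup K] [Module A K]
    [AddCommGroup M] [Module A M] {d : ℕ} (κ : Ext (ModuleCat.of A K) (ModuleCat.of A M) d)
    (U : Submodule A N) :
    (U →ₗ[A] K) →ₗ[A] Ext (ModuleCat.of A (N ⧸ U)) (ModuleCat.of A M) (d + 1) where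
  toFun g := ((submodule_shortExact U).extClass.comp (Ext.mk₀ (ModuleCat.ofHom g))
    (add_zero 1)).comp κ (add_comm 1 d)
  map_add' g h := by
    rw [ModuleCat.ofHom_add, Ext.mk₀_add, Ext.comp_add, Ext.add_comp]
  map_smul' a g := by
    have : ModuleCat.ofHom (a • g) = a • ModuleCat.ofHom g := rfl
    rw [this, Ext.mk₀_smul, Ext.comp_smul, Ext.smul_comp]
    rfl

/-- Multiplication by a is a morphism between the sequences U → N → N/U, so naturality of the
extension class turns the Rees action on Ext into precomposition on Hom(U, K). -/
theorem extMap_mulQuot_extOfHom {I : Ideal A} {N K M : Type u} [AddCommGroup N] [Module A N]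
    [AddCommGroup K] [Module A K] [AddCommGroup M] [Module A M] {d : ℕ}
    (κ : Ext (ModuleCat.of A K) (ModuleCat.of A M) d) (i n : ℕ) (a : ↥(I ^ i))
    (g : ↥(I ^ (n + i + 1) • (⊤ : Submodule A N)) →ₗ[A] K) :
    extMap M (d + 1) (mulQuot I N rfl a) (extOfHom κ _ g) =
      extOfHom κ _ (g ∘ₗ mulSub i n a) := by
  let φ : exactSC (LinearMap.exact_subtype_mkQ (I ^ (n + 1) • (⊤ : Submodule A N))) ⟶
      exactSC (LinearMap.exact_subtype_mkQ (I ^ (n + i + 1) • (⊤ : Submodule A N))) :=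
    { τ₁ := ModuleCat.ofHom (mulSub i n a)
      τ₂ := ModuleCat.ofHom (LinearMap.lsmul A N (a : A))
      τ₃ := ModuleCat.ofHom (mulQuot I N rfl a)
      comm₁₂ := rfl
      comm₂₃ := rfl }
  have h := ShortComplex.ShortExact.extClass_naturality (submodule_shortExact _)
    (submodule_shortExact _) φ
  rw [extMap_apply]
  change (Ext.mk₀ φ.τ₃).comp (((submodule_shortExact _).extClass.comp (Ext.mk₀ (ModuleCat.ofHom g))
    (add_zero 1)).comp κ (add_comm 1 d)) (zero_add (d + 1)) =
    ((submodule_shortExact _).extClass.comp (Ext.mk₀ (φ.τ₁ ≫ ModuleCat.ofHom g))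
    (add_zero 1)).comp κ (add_comm 1 d)
  rw [← Ext.comp_assoc (Ext.mk₀ φ.τ₃) _ κ (zero_add 1) (add_comm 1 d) (by omega),
    ← Ext.comp_assoc (Ext.mk₀ φ.τ₃) _ _ (zero_add 1) (add_zero 1) (by omega), ← h,
    Ext.comp_assoc _ (Ext.mk₀ φ.τ₁) _ (add_zero 1) (add_zero 0) (by omega),
    Ext.mk₀_comp_mk₀]

/-- This is surjectivity of U ⊗ K^∨ → Hom(U, K)^∨ for finite U: generators of U embed Hom(U, K) in
K^p, and functionals extend to K^p because E is injective. -/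
theorem exists_dual_eq_sum {U K E : Type u} [AddCommGroup U] [Module A U] [Module.Finite A U]
    [AddCommGroup K] [Module A K] [AddCommGroup E] [Module A E] [Module.Injective A E]
    {s : ℕ} {q : Fin s → (K →ₗ[A] E)} (hq : Submodule.span A (Set.range q) = ⊤)
    (w : (U →ₗ[A] K) →ₗ[A] E) : ∃ u : Fin s → U, ∀ g, w g = ∑ l, q l (g (u l)) := by
  obtain ⟨p, x, hx⟩ := Module.Finite.exists_fin (R := A) (M := U)
  let F : (U →ₗ[A] K) →ₗ[A] (Fin p → K) := LinearMap.pi fun i => LinearMap.applyₗ (x i)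
  have hF : Function.Injective F := by
    intro g h hgh
    refine LinearMap.ext_on_range hx fun i => ?_
    exact congrFun hgh i
  obtain ⟨h, hh⟩ := Module.Injective.extension_property A (M := E) _ _ F hF w
  have hc : ∀ i, ∃ c : Fin s → A, ∑ l, c l • q l = h ∘ₗ LinearMap.single A (fun _ => K) i :=
    fun i => (Submodule.mem_span_range_iff_exists_fun A).1 (hq ▸ Submodule.mem_top)
  choose c hc using hc
  refine ⟨fun l => ∑ i, c i l • x i, fun g => ?_⟩
  have h1 : w g = h (F g) := (LinearMap.congr_fun hh g).symm
  have h2 : F g = ∑ i, LinearMap.single A (fun _ => K) i (g (x i)) := by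
    funext j
    simp [F, Finset.sum_apply, Pi.single_apply]
  rw [h1, h2, map_sum]
  simp only [map_sum, map_smul]
  rw [Finset.sum_comm]
  refine Finset.sum_congr rfl fun i _ => ?_
  have := LinearMap.congr_fun (hc i) (g (x i))
  simpa using this.symm

/-- V(M) sits inside the duals of the modules Hom(I^{n+1}N, K), each covered by degree n of a free
Rees module with one generator for every pair (generator of K^∨, generator of IN). Over the
Noetherian Rees algebra such a subquotient is finite. -/
theorem finite_dualSum [IsNoetherianRing A] {I : Ideal A} {N K M E : Type u} [AddCommGroup N]
    [Module A N] [Module.Finite A N] [AddCommGroup K] [Module A K] [AddCommGroup M] [Module A M]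
    [AddCommGroup E] [Module A E] [Module.Injective A E] [Module.Finite A (K →ₗ[A] E)] {d : ℕ}
    (κ : Ext (ModuleCat.of A K) (ModuleCat.of A M) d)
    (hκ : ∀ n, Function.Surjective (extOfHom κ (I ^ (n + 1) • (⊤ : Submodule A N)))) :
    Module.Finite (reesAlgebra I) (DualSum I N M E (d + 1)) := by
  have hN := isNoetherian_of_isNoetherianRing_of_finite A N
  obtain ⟨s, q, hq⟩ := Module.Finite.exists_fin (R := A) (M := K →ₗ[A] E)
  obtain ⟨p, y, hy⟩ := Module.Finite.exists_fin (R := A) (M := ↥(I • (⊤ : Submodule A N)))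
  -- `rel f v` says that f, in the free module, and v, in V(M), induce the same functional on
  -- Hom(I^{n+1}N, K) for every n. The submodule P of such pairs is the pullback: it embeds in the
  -- free module, because surjectivity of `extOfHom` lets f = 0 force v = 0, and it maps onto V(M).
  let rel (f : Fin s → Fin p → reesAlgebra I) (v : DualSum I N M E (d + 1)) : Prop :=
    ∀ n (g : ↥(I ^ (n + 1) • (⊤ : Submodule A N)) →ₗ[A] K),
      proj I N M E (d + 1) n v (extOfHom κ _ g) =
        ∑ l, ∑ i, q l (g (mulMem n (y i) (coeffHom I n (f l i))))
  have rel_add : ∀ f f' v v', rel f v → rel f' v' → rel (f + f') (v + v') := by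
    intro f f' v v' h h' n g
    simp only [Pi.add_apply, map_add, LinearMap.add_apply, Finset.sum_add_distrib]
    rw [h, h']
  have rel_zero : rel 0 0 := by
    intro n g
    simp
  have rel_monomial : ∀ i (a : ↥(I ^ i)) f v, rel f v →
      rel (reesMonomial I i a • f) (reesMonomial I i a • v) := by
    intro i a f v h n g
    obtain hn | ⟨n, rfl⟩ : n < i ∨ ∃ m, n = m + i := by
      rcases lt_or_ge n i with h | h
      · exact Or.inl h
      · exact Or.inr ⟨n - i, by omega⟩
    · rw [proj_smul_of_lt hn]
      simp only [Pi.smul_apply, smul_eq_mul, coeffHom_reesMonomial_mul_of_lt hn, map_zero,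
        Finset.sum_const_zero, LinearMap.zero_apply]
    · rw [proj_smul_add]
      change proj I N M E (d + 1) n v (extMap M (d + 1) (mulQuot I N rfl a) (extOfHom κ _ g)) = _
      rw [extMap_mulQuot_extOfHom, h]
      refine Finset.sum_congr rfl fun l _ => Finset.sum_congr rfl fun b _ => ?_
      refine congrArg (fun z => q l (g z)) (Subtype.ext ?_)
      change (a : A) • ((coeffHom I n (f l b) : A) • (y b : N)) =
        (coeffHom I (n + i) (reesMonomial I i a * f l b) : A) • (y b : N)
      rw [coeffHom_reesMonomial_mul_add, mul_smul]
  let P : Submodule (reesAlgebra I)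
      ((Fin s → Fin p → reesAlgebra I) × DualSum I N M E (d + 1)) :=
    { carrier := {z | rel z.1 z.2}
      zero_mem' := rel_zero
      add_mem' := fun {z w} hz hw => rel_add _ _ _ _ hz hw
      smul_mem' := by
        intro c z hz
        rw [sum_reesMonomial c, Finset.sum_smul]
        exact Finset.sum_induction _
          (fun z : (Fin s → Fin p → reesAlgebra I) × DualSum I N M E (d + 1) => rel z.1 z.2)
          (fun z w => rel_add _ _ _ _) rel_zero fun i _ => rel_monomial _ _ _ _ hz }
  have hinj : Function.Injective ((LinearMap.fst (reesAlgebra I) _ _).comp P.subtype) := by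
    refine (injective_iff_map_eq_zero _).2 ?_
    rintro ⟨⟨f, v⟩, hz⟩ (rfl : f = 0)
    have : v = 0 := by
      refine dualSum_ext fun n => LinearMap.ext fun e => ?_
      obtain ⟨g, rfl⟩ := hκ n e
      rw [hz n g]
      simp
    subst this
    rfl
  have : Module.Finite (reesAlgebra I) P := Module.Finite.of_injective _ hinj
  refine Module.Finite.of_surjective ((LinearMap.snd (reesAlgebra I) _ _).comp P.subtype) ?_
  intro v
  suffices ∃ f, rel f v from ⟨⟨(_, v), this.choose_spec⟩, rfl⟩
  induction v using dualSum_induction with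
  | zero => exact ⟨0, rel_zero⟩
  | add x y hx hy =>
    obtain ⟨f, hf⟩ := hx
    obtain ⟨f', hf'⟩ := hy
    exact ⟨f + f', rel_add _ _ _ _ hf hf'⟩
  | incl n w =>
    -- The tensor representation uses elements of I^{n+1}N; writing them as combinations of
    -- generators of IN with coefficients in I^n gives homogeneous elements of degree n.
    obtain ⟨u, hu⟩ := exists_dual_eq_sum hq (w ∘ₗ extOfHom κ _)
    choose a ha using fun l => exists_eq_sum_mulMem hy n (u l)
    refine ⟨fun l i => reesMonomial I n (a l i), fun m g => ?_⟩
    by_cases hmn : n = m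
    · subst hmn
      rw [proj_incl_self]
      refine (hu g).trans (Finset.sum_congr rfl fun l _ => ?_)
      rw [ha l, map_sum, map_sum]
      simp only [coeffHom_reesMonomial_self]
    · rw [proj_incl_of_ne hmn]
      simp only [coeffHom_reesMonomial_of_ne hmn, map_zero,
        Finset.sum_const_zero, LinearMap.zero_apply]

/-! ### The Hilbert–Serre theorem for families with commuting operators. -/

section HilbertSerre

variable {V : ℕ → Type u} [∀ n, AddCommGroup (V n)] [∀ n, Module A (V n)]

/-- A family of submodules stable under the first `g` operators. -/
def IsStable (f : ℕ → ∀ n, V n →ₗ[A] V (n + 1)) (g : ℕ) (S : ∀ n, Submodule A (V n)) : Prop :=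
  ∀ i < g, ∀ n, ∀ x ∈ S n, f i n x ∈ S (n + 1)

/-- The ascending chain condition for families of submodules stable under the first `g`
operators. -/
def IsGradedNoetherian (f : ℕ → ∀ n, V n →ₗ[A] V (n + 1)) (g : ℕ) : Prop :=
  ∀ S : ℕ → ∀ n, Submodule A (V n), (∀ k, IsStable f g (S k)) → Monotone S →
    ∃ k₀, ∀ k, k₀ ≤ k → S k₀ = S k

/-- The images of one operator, in every degree. -/
def rangeFamily (f : ∀ n, V n →ₗ[A] V (n + 1)) : ∀ n, Submodule A (V n)
  | 0 => ⊥
  | n + 1 => LinearMap.range (f n)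

theorem IsGradedNoetherian.eventually_subsingleton {f : ℕ → ∀ n, V n →ₗ[A] V (n + 1)}
    (h : IsGradedNoetherian f 0) : ∃ k, ∀ n, k ≤ n → Subsingleton (V n) := by
  -- With no operators every family is stable, in particular the truncations below degree k; their
  -- stabilising forces V to vanish in high degrees.
  obtain ⟨k, hk⟩ := h (fun k n => if n < k then ⊤ else ⊥) (fun k i hi => absurd hi (by omega))
    (fun k l hkl n => by
      by_cases hn : n < k
      · simp [hn, hn.trans_le hkl]
      · simp [hn])
  refine ⟨k, fun n hn => ?_⟩
  have := congrFun (hk (n + 1) (by omega)) n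
  simp only [if_neg (not_lt.2 hn), if_pos (Nat.lt_succ_self n)] at this
  exact (Submodule.subsingleton_iff A).1 (subsingleton_of_bot_eq_top this)

/-- Additivity of length along 0 → ker f → X → Y → coker f → 0, written without subtraction. -/
theorem toNat_length_add_toNat_length {X Y : Type u} [AddCommGroup X] [Module A X]
    [AddCommGroup Y] [Module A Y] (f : X →ₗ[A] Y) (hX : Module.length A X ≠ ⊤)
    (hY : Module.length A Y ≠ ⊤) :
    (Module.length A Y).toNat + (Module.length A (LinearMap.ker f)).toNat =
      (Module.length A X).toNat + (Module.length A (Y ⧸ LinearMap.range f)).toNat := by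
  have h1 := Module.length_eq_add_of_exact (LinearMap.ker f).subtype f.rangeRestrict
    (Submodule.injective_subtype _) f.surjective_rangeRestrict
    (by rw [LinearMap.exact_iff, LinearMap.ker_rangeRestrict, Submodule.range_subtype])
  have h2 := Module.length_eq_add_of_exact (LinearMap.range f).subtype (LinearMap.range f).mkQ
    (Submodule.injective_subtype _) (Submodule.mkQ_surjective _) (LinearMap.exact_subtype_mkQ _)
  rw [h1] at hX ⊢
  rw [h2] at hY ⊢
  obtain ⟨a1, a2⟩ := WithTop.add_ne_top.1 hX
  obtain ⟨b1, b2⟩ := WithTop.add_ne_top.1 hY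
  rw [ENat.toNat_add a1 a2, ENat.toNat_add b1 b2]
  omega

open PowerSeries in
/-- The Hilbert–Serre theorem: the Hilbert series is a rational function with denominator
`(1 - X) ^ g`. -/
theorem exists_hilbertSeries_eq (g : ℕ) (f : ℕ → ∀ n, V n →ₗ[A] V (n + 1))
    (hcomm : ∀ i j n x, f i (n + 1) (f j n x) = f j (n + 1) (f i n x))
    (hf : IsGradedNoetherian f g) (hfin : ∀ n, Module.length A (V n) ≠ ⊤) :
    ∃ p : Polynomial ℚ, (1 - X) ^ g *
      PowerSeries.mk (fun n => ((Module.length A (V n)).toNat : ℚ)) = (p : PowerSeries ℚ) := by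
  induction g generalizing V with
  | zero =>
    obtain ⟨k, hk⟩ := hf.eventually_subsingleton
    refine ⟨trunc k (PowerSeries.mk (fun n => ((Module.length A (V n)).toNat : ℚ))), ?_⟩
    ext n
    rw [pow_zero, one_mul, Polynomial.coeff_coe, coeff_trunc, coeff_mk]
    split_ifs with hn
    · rfl
    · have := hk n (not_lt.1 hn)
      simp
  | succ g ih =>
    -- The last operator acts as zero on its kernel and its cokernel, so there stability under g
    -- operators amounts to stability under g + 1, and the chain condition descends.
    let K n := LinearMap.ker (f g n)
    let R := rangeFamily (f g)
    have hK : ∀ i n, ∀ x ∈ K n, f i n x ∈ K (n + 1) := by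
      intro i n x hx
      rw [LinearMap.mem_ker] at hx ⊢
      rw [hcomm, hx, map_zero]
    have hR : ∀ i n, R n ≤ (R (n + 1)).comap (f i n) := by
      intro i n x hx
      cases n with
      | zero =>
        obtain rfl : x = 0 := hx
        exact Submodule.zero_mem _
      | succ n =>
        obtain ⟨y, rfl⟩ := hx
        exact ⟨f i n y, (hcomm _ _ _ _)⟩
    obtain ⟨p, hp⟩ := ih (V := fun n => K n) (fun i n => (f i n).restrict (hK i n))
      (fun i j n x => Subtype.ext (hcomm i j n x)) (by
        intro S hS hmono
        obtain ⟨k₀, h⟩ := hf (fun k n => (S k n).map (K n).subtype) (by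
          rintro k i hi n _ ⟨x, hx, rfl⟩
          by_cases hig : i = g
          · subst hig
            rw [show f i n ((K n).subtype x) = 0 from x.2]
            exact zero_mem _
          · exact ⟨_, hS k i (by omega) n x hx, rfl⟩)
          (fun k l hkl n => Submodule.map_mono (hmono hkl n))
        exact ⟨k₀, fun k hk => funext fun n =>
          Submodule.map_injective_of_injective (K n).injective_subtype (congrFun (h k hk) n)⟩)
      (fun n => ne_top_of_le_ne_top (hfin n)
        (Module.length_le_of_injective (K n).subtype (K n).injective_subtype))
    obtain ⟨q, hq⟩ := ih (V := fun n => V n ⧸ R n)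
      (fun i n => (R n).mapQ (R (n + 1)) (f i n) (hR i n))
      (fun i j n x => by
        obtain ⟨x, rfl⟩ := Submodule.mkQ_surjective _ x
        exact congrArg (R (n + 1 + 1)).mkQ (hcomm i j n x)) (by
        intro S hS hmono
        obtain ⟨k₀, h⟩ := hf (fun k n => (S k n).comap (R n).mkQ) (by
          intro k i hi n x hx
          by_cases hig : i = g
          · subst hig
            have : (R (n + 1)).mkQ (f i n x) = 0 :=
              (Submodule.Quotient.mk_eq_zero _).2 ⟨x, rfl⟩
            rw [Submodule.mem_comap, this]
            exact zero_mem _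
          · exact hS k i (by omega) n _ hx)
          (fun k l hkl n => Submodule.comap_mono (hmono hkl n))
        exact ⟨k₀, fun k hk => funext fun n =>
          Submodule.comap_injective_of_surjective (R n).mkQ_surjective (congrFun (h k hk) n)⟩)
      (fun n => ne_top_of_le_ne_top (hfin n)
        (Module.length_le_of_surjective (R n).mkQ (R n).mkQ_surjective))
    refine ⟨q - Polynomial.X * p, ?_⟩
    -- The four-term exact sequence in each degree; in degree 0 nothing is divided out because
    -- `rangeFamily` is zero there.
    have key : (1 - X) * PowerSeries.mk (fun n => ((Module.length A (V n)).toNat : ℚ)) =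
        PowerSeries.mk (fun n => ((Module.length A (V n ⧸ R n)).toNat : ℚ)) -
          X * PowerSeries.mk (fun n => ((Module.length A (K n)).toNat : ℚ)) := by
      ext n
      rw [sub_mul, one_mul, map_sub, map_sub, coeff_mk, coeff_mk]
      cases n with
      | zero =>
        rw [coeff_zero_X_mul, coeff_zero_X_mul, sub_zero, sub_zero,
          (Submodule.quotEquivOfEqBot (R 0) rfl).length_eq]
      | succ n =>
        rw [coeff_succ_X_mul, coeff_succ_X_mul, coeff_mk, coeff_mk, sub_eq_sub_iff_add_eq_add]
        have := toNat_length_add_toNat_length (f g n) (hfin n) (hfin (n + 1))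
        rw [add_comm (Nat.cast _) (Nat.cast (Module.length A (V n)).toNat)]
        exact_mod_cast this
    rw [pow_succ, mul_assoc, key, mul_sub, hq, mul_left_comm, hp]
    simp

end HilbertSerre

theorem exists_polynomial_of_hilbertSeries_eq {h : ℕ → ℕ} {g : ℕ} {p : Polynomial ℚ}
    (hp : (1 - PowerSeries.X) ^ g * PowerSeries.mk (fun n => (h n : ℚ)) = (p : PowerSeries ℚ)) :
    ∃ P : Polynomial ℚ, ∀ᶠ n : ℕ in Filter.atTop, (h n : ℚ) = P.eval (n : ℚ) := by
  refine ⟨Polynomial.hilbertPoly p g, ?_⟩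
  filter_upwards [Filter.eventually_gt_atTop p.natDegree] with n hn
  rw [← Polynomial.coeff_mul_invOneSubPow_eq_hilbertPoly_eval g hn, ← hp]
  have : (1 - PowerSeries.X) ^ g * (PowerSeries.invOneSubPow ℚ g : PowerSeries ℚ) = 1 := by
    rw [← PowerSeries.invOneSubPow_inv_eq_one_sub_pow]
    exact Units.inv_mul _
  rw [mul_right_comm, this, one_mul, PowerSeries.coeff_mk]

/-! ### Eventual polynomiality of the lengths of the components of V(M). -/

section Application

variable {I : Ideal A} {N M E : Type u} [AddCommGroup N] [Module A N] [AddCommGroup M] [Module A M]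
  [AddCommGroup E] [Module A E] {j : ℕ}

theorem act_smul {i m n : ℕ} (h : n = m + i) (c : A) (a : ↥(I ^ i)) :
    act I N M E j h (c • a) = c • act I N M E j h a := by
  have : mulQuot I N h (c • a) = c • mulQuot I N h a := by
    refine Submodule.linearMap_qext _ (LinearMap.ext fun x => ?_)
    simp [mulQuot, mul_smul]
  ext v x
  simp [act, this, extMap_smul]

/-- The map `I ^ i → V(M)_n`, `a ↦ (a t ^ i) v`, for `v` of degree `m` and `n = m + i`. -/
def actAt {i m n : ℕ} (h : n = m + i) (v : DualPart I N M E j m) :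
    ↥(I ^ i) →ₗ[A] DualPart I N M E j n where
  toFun a := act I N M E j h a v
  map_add' a b := by rw [act_add]; rfl
  map_smul' c a := by rw [act_smul]; rfl

theorem actAt_apply {i m n : ℕ} (h : n = m + i) (v : DualPart I N M E j m) (a : ↥(I ^ i)) :
    actAt h v a = act I N M E j h a v := rfl

theorem act_zero_degree {m : ℕ} (h : m = m + 0) (a : ↥(I ^ 0)) (v : DualPart I N M E j m) :
    act I N M E j h a v = (a : A) • v := by
  have : a = (a : A) • (⟨1, by simp⟩ : ↥(I ^ 0)) := Subtype.ext (by simp)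
  rw [← actAt_apply, this, map_smul, actAt_apply, act_one _ rfl]
  simp

theorem act_act_of_eq {i k l m n p : ℕ} (h : n = m + i) (h' : p = n + k) (h'' : p = m + l)
    (a : ↥(I ^ i)) (b : ↥(I ^ k)) (c : ↥(I ^ l)) (hc : (c : A) = b * a)
    (v : DualPart I N M E j m) :
    act I N M E j h' b (act I N M E j h a v) = act I N M E j h'' c v := by
  obtain rfl : l = k + i := by omega
  exact act_act h h' h'' a b c hc v

/-- I^i is generated by i-fold products of elements of I, so stability under generators of I gives
stability under the whole Rees algebra. -/
theorem act_mem_of_isStable {g : ℕ} {a : Fin g → ↥(I ^ 1)}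
    (ha : Submodule.span A (Set.range a) = ⊤) {S : ∀ n, Submodule A (DualPart I N M E j n)}
    (hS : ∀ l n, ∀ v ∈ S n, act I N M E j rfl (a l) v ∈ S (n + 1)) {i m n : ℕ} (h : n = m + i)
    (b : ↥(I ^ i)) {v : DualPart I N M E j m} (hv : v ∈ S m) : act I N M E j h b v ∈ S n := by
  have h1 : ∀ (c : ↥(I ^ 1)) (n) (w : DualPart I N M E j n), w ∈ S n →
      act I N M E j rfl c w ∈ S (n + 1) := by
    intro c n w hw
    have hc : c ∈ Submodule.span A (Set.range a) := ha ▸ Submodule.mem_top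
    have hle : Submodule.span A (Set.range a) ≤ (S (n + 1)).comap (actAt rfl w) := by
      rw [Submodule.span_le]
      rintro _ ⟨l, rfl⟩
      exact hS l n w hw
    exact hle hc
  induction i generalizing n with
  | zero =>
    obtain rfl : n = m := h
    rw [act_zero_degree]
    exact (S n).smul_mem _ hv
  | succ i ih =>
    subst h
    suffices ∃ hb : (b : A) ∈ I ^ (i + 1), act I N M E j rfl ⟨b, hb⟩ v ∈ S (m + (i + 1)) from
      this.2
    have hb : (b : A) ∈ I * I ^ i := pow_succ' I i ▸ b.2
    refine Submodule.mul_induction_on hb (fun c hc y hy => ?_) fun x y hx hy => ?_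
    · refine ⟨by rw [pow_succ']; exact Ideal.mul_mem_mul hc hy, ?_⟩
      rw [← act_act_of_eq (rfl : m + i = m + i) (rfl : m + (i + 1) = m + i + 1) rfl ⟨y, hy⟩
        ⟨c, by rwa [pow_one]⟩ _ rfl]
      exact h1 _ (m + i) _ (ih rfl ⟨y, hy⟩)
    · obtain ⟨hx, hx'⟩ := hx
      obtain ⟨hy, hy'⟩ := hy
      exact ⟨add_mem hx hy, (actAt rfl v).map_add ⟨x, hx⟩ ⟨y, hy⟩ ▸ add_mem hx' hy'⟩

/-- A stable family is the family of components of a graded Rees submodule of V(M), so chains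
stabilise because V(M) is Noetherian. -/
theorem isGradedNoetherian_dualPart [IsNoetherianRing A]
    [Module.Finite (reesAlgebra I) (DualSum I N M E j)]
    {f : ℕ → ∀ n, DualPart I N M E j n →ₗ[A] DualPart I N M E j (n + 1)} {g : ℕ}
    {a : Fin g → ↥(I ^ 1)} (ha : Submodule.span A (Set.range a) = ⊤)
    (hf : ∀ l : Fin g, ∀ n, f l n = act I N M E j rfl (a l)) : IsGradedNoetherian f g := by
  intro S hS hmono
  have hnoeth := isNoetherian_of_isNoetherianRing_of_finite (reesAlgebra I) (DualSum I N M E j)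
  have hact : ∀ k {i m n : ℕ} (h : n = m + i) (b : ↥(I ^ i)) {v : DualPart I N M E j m},
      v ∈ S k m → act I N M E j h b v ∈ S k n := fun k _ _ _ h b _ hv =>
    act_mem_of_isStable ha (fun l n v hv => by
      rw [← hf]
      exact hS k l l.2 n v hv) h b hv
  let P (k : ℕ) : Submodule (reesAlgebra I) (DualSum I N M E j) :=
    { carrier := {v | ∀ n, proj I N M E j n v ∈ S k n}
      zero_mem' := fun n => by rw [map_zero]; exact zero_mem _
      add_mem' := fun {v w} hv hw n => by rw [map_add]; exact add_mem (hv n) (hw n)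
      smul_mem' := fun c v hv n => by
        rw [sum_reesMonomial c, Finset.sum_smul, map_sum]
        refine sum_mem fun i _ => ?_
        rcases lt_or_ge n i with h | h
        · rw [proj_smul_of_lt h]
          exact zero_mem _
        · obtain ⟨m, rfl⟩ := Nat.exists_eq_add_of_le' h
          rw [proj_smul_add]
          exact hact k rfl _ (hv m) }
  obtain ⟨k₀, hk₀⟩ := monotone_stabilizes_iff_noetherian.2 hnoeth
    ⟨P, fun k l hkl v hv n => hmono hkl n (hv n)⟩
  refine ⟨k₀, fun k hk => le_antisymm (hmono hk) fun n x hx => ?_⟩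
  have hx' : incl I N M E j n x ∈ P k := by
    intro m
    by_cases hm : n = m
    · subst hm
      rwa [proj_incl_self]
    · rw [proj_incl_of_ne hm]
      exact zero_mem _
  have hP : P k₀ = P k := hk₀ k hk
  rw [← hP] at hx'
  have := hx' n
  rwa [proj_incl_self] at this

/-- The lengths of the components of `V(M)` are eventually polynomial. -/
theorem exists_polynomial_length [IsNoetherianRing A]
    [Module.Finite (reesAlgebra I) (DualSum I N M E j)]
    (hfin : ∀ n, Module.length A (DualPart I N M E j n) ≠ ⊤) :
    ∃ P : Polynomial ℚ, ∀ᶠ n : ℕ in Filter.atTop,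
      ((Module.length A (DualPart I N M E j n)).toNat : ℚ) = P.eval (n : ℚ) := by
  have hfg := isNoetherian_of_isNoetherianRing_of_finite A ↥(I ^ 1)
  obtain ⟨g, a, ha⟩ := Module.Finite.exists_fin (R := A) (M := ↥(I ^ 1))
  let b (i : ℕ) : ↥(I ^ 1) := if h : i < g then a ⟨i, h⟩ else 0
  obtain ⟨p, hp⟩ := exists_hilbertSeries_eq g (fun i n => act I N M E j rfl (b i))
    (fun i k n x => by
      rw [act_act rfl rfl rfl (b k) (b i) ⟨(b i : A) * b k, by
          rw [pow_add]; exact Ideal.mul_mem_mul (b i).2 (b k).2⟩ rfl,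
        act_act rfl rfl rfl (b i) (b k) ⟨(b i : A) * b k, by
          rw [pow_add]; exact Ideal.mul_mem_mul (b i).2 (b k).2⟩ (mul_comm _ _)])
    (isGradedNoetherian_dualPart ha fun l n => by simp [b]) hfin
  exact exists_polynomial_of_hilbertSeries_eq hp

end Application

/-! ### Growth of ℓ(A/(ann N + I^n)) and comparison of growth with degree. -/

section

open IsLocalRing

theorem length_le_add_of_ker_le_range {X Y Z : Type*} [AddCommGroup X] [Module A X]
    [AddCommGroup Y] [Module A Y] [AddCommGroup Z] [Module A Z] (f : X →ₗ[A] Y) (g : Y →ₗ[A] Z)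
    (h : LinearMap.ker g ≤ LinearMap.range f) (hg : Function.Surjective g) :
    Module.length A Y ≤ Module.length A X + Module.length A Z := by
  rw [Module.length_eq_add_of_exact (LinearMap.ker g).subtype g (Submodule.injective_subtype _) hg
    (LinearMap.exact_subtype_ker_map g)]
  gcongr
  exact (Module.length_le_of_injective _ (Submodule.inclusion_injective h)).trans
    (Module.length_le_of_surjective _ f.surjective_rangeRestrict)

theorem length_quotient_sup_span_pow_le (J : Ideal A) (x : A) (n : ℕ) :
    Module.length A (A ⧸ (J ⊔ Ideal.span {x ^ n})) ≤
      n * Module.length A (A ⧸ (J ⊔ Ideal.span {x})) := by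
  induction n with
  | zero =>
    have : J ⊔ Ideal.span {x ^ 0} = ⊤ := by simp
    rw [this, Nat.cast_zero, zero_mul, Module.length_eq_zero]
  | succ n ih =>
    have hle : J ⊔ Ideal.span {x ^ (n + 1)} ≤ J ⊔ Ideal.span {x ^ n} :=
      sup_le_sup le_rfl (Ideal.span_singleton_le_span_singleton.2 (pow_dvd_pow x n.le_succ))
    -- Multiplication by x^n maps A/(J, x) onto the kernel of A/(J, x^{n+1}) → A/(J, x^n), so each
    -- power adds at most one copy of ℓ(A/(J, x)).
    have hmul : J ⊔ Ideal.span {x} ≤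
        Submodule.comap (LinearMap.lsmul A A (x ^ n)) (J ⊔ Ideal.span {x ^ (n + 1)}) := by
      refine sup_le (fun a ha => ?_) ?_
      · exact Ideal.mul_mem_left _ _ (Ideal.mem_sup_left ha)
      · rw [Ideal.span_le, Set.singleton_subset_iff]
        change x ^ n * x ∈ J ⊔ Ideal.span {x ^ (n + 1)}
        rw [← pow_succ]
        exact Ideal.mem_sup_right (Ideal.mem_span_singleton_self _)
    refine (length_le_add_of_ker_le_range (Submodule.mapQ _ _ _ hmul) (Submodule.factor hle) ?_
      (Submodule.factor_surjective hle)).trans ?_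
    · intro y hy
      obtain ⟨a, rfl⟩ := Submodule.Quotient.mk_surjective _ y
      have ha : a ∈ J ⊔ Ideal.span {x ^ n} := (Submodule.Quotient.mk_eq_zero _).1 hy
      obtain ⟨b, hb, c, hc, rfl⟩ := Submodule.mem_sup.1 ha
      obtain ⟨c, rfl⟩ := Ideal.mem_span_singleton'.1 hc
      refine ⟨Submodule.Quotient.mk c, ?_⟩
      refine (Submodule.Quotient.eq _).2 ?_
      have : x ^ n * c - (b + c * x ^ n) = -b := by ring
      change x ^ n * c - (b + c * x ^ n) ∈ _
      rw [this]
      exact neg_mem (Ideal.mem_sup_left hb)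
    · rw [Nat.cast_succ, add_mul, one_mul, add_comm]
      gcongr

theorem length_quotient_sup_span_image_pow_le (J : Ideal A) (s : Finset A) (n : ℕ) :
    Module.length A (A ⧸ (J ⊔ Ideal.span ((· ^ n) '' (s : Set A)))) ≤
      (n ^ s.card : ℕ) * Module.length A (A ⧸ (J ⊔ Ideal.span (s : Set A))) := by
  classical
  induction s using Finset.induction_on generalizing J with
  | empty =>
    rw [Finset.coe_empty, Set.image_empty, Finset.card_empty, pow_zero, Nat.cast_one, one_mul]
  | insert x s hx ih =>
    have h1 : J ⊔ Ideal.span ((· ^ n) '' ((insert x s : Finset A) : Set A)) =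
        (J ⊔ Ideal.span {x ^ n}) ⊔ Ideal.span ((· ^ n) '' (s : Set A)) := by
      rw [Finset.coe_insert, Set.image_insert_eq, Ideal.span_insert, sup_assoc]
    have h2 : J ⊔ Ideal.span ((insert x s : Finset A) : Set A) =
        (J ⊔ Ideal.span (s : Set A)) ⊔ Ideal.span {x} := by
      rw [Finset.coe_insert, Ideal.span_insert, sup_right_comm, sup_assoc]
    rw [h1, h2, Finset.card_insert_of_notMem hx, pow_succ, Nat.cast_mul, mul_assoc]
    refine (ih _).trans (mul_le_mul' le_rfl ?_)
    rw [sup_right_comm]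
    exact length_quotient_sup_span_pow_le _ _ _

/-- Parameters modulo an ideal. -/
theorem exists_parameters [IsLocalRing A] [IsNoetherianRing A] {J : Ideal A} {r : ℕ}
    (hr : ringKrullDim (A ⧸ J) = r) :
    ∃ s : Finset A, s.card = r ∧ (s : Set A) ⊆ maximalIdeal A ∧
      ∃ t, maximalIdeal A ^ t ≤ J ⊔ Ideal.span (s : Set A) := by
  classical
  have hnt : Nontrivial (A ⧸ J) := by
    by_contra h
    rw [not_nontrivial_iff_subsingleton] at h
    rw [ringKrullDim_eq_bot_of_subsingleton] at hr
    exact absurd hr (WithBot.bot_ne_coe)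
  have hloc : IsLocalRing (A ⧸ J) :=
    IsLocalRing.of_surjective' (Ideal.Quotient.mk J) Ideal.Quotient.mk_surjective
  have hlh : IsLocalHom (Ideal.Quotient.mk J) :=
    IsLocalHom.of_surjective _ Ideal.Quotient.mk_surjective
  obtain ⟨s, hs, hcard⟩ :=
    Ideal.exists_finset_card_eq_height_of_isNoetherianRing (maximalIdeal (A ⧸ J))
  have hsurj := Ideal.Quotient.mk_surjective (I := J)
  have hinv := Function.rightInverse_surjInv hsurj
  refine ⟨s.image (Function.surjInv hsurj), ?_, ?_, ?_⟩
  · rw [Finset.card_image_of_injective _ (Function.injective_surjInv hsurj)]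
    rw [← maximalIdeal_height_eq_ringKrullDim, ← hcard] at hr
    exact_mod_cast hr
  · rw [Finset.coe_image]
    rintro _ ⟨b, hb, rfl⟩
    have h1 : b ∈ maximalIdeal (A ⧸ J) := hs.1.2 (Ideal.subset_span hb)
    rw [← hinv b] at h1
    exact (map_mem_nonunits_iff (Ideal.Quotient.mk J) _).1 h1
  · refine Ideal.exists_pow_le_of_le_radical_of_fg ?_ (IsNoetherian.noetherian _)
    rw [Ideal.radical_eq_sInf]
    refine le_sInf fun P ⟨hP, hPprime⟩ a ha => ?_
    have hJP : J ≤ P := le_sup_left.trans hP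
    have hprime : (P.map (Ideal.Quotient.mk J)).IsPrime :=
      Ideal.map_isPrime_of_surjective hsurj (by rwa [Ideal.mk_ker])
    have hle : Ideal.span (s : Set (A ⧸ J)) ≤ P.map (Ideal.Quotient.mk J) := by
      rw [Ideal.span_le]
      intro b hb
      rw [← hinv b]
      refine Ideal.mem_map_of_mem _ (hP (Ideal.mem_sup_right (Ideal.subset_span ?_)))
      rw [Finset.coe_image]
      exact ⟨b, hb, rfl⟩
    have h1 := hs.2 ⟨hprime, hle⟩ (le_maximalIdeal hprime.ne_top)
      ((map_mem_nonunits_iff (Ideal.Quotient.mk J) a).2 ha)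
    obtain ⟨b, hb, hab⟩ := (Ideal.mem_map_iff_of_surjective _ hsurj).1 h1
    have := hJP (Ideal.Quotient.eq.1 hab)
    rwa [P.sub_mem_iff_right hb] at this

/-- By Cayley–Hamilton, multiplication by a satisfies a monic polynomial whose lower coefficients
lie in I; its value at a annihilates N. -/
theorem exists_pow_mem_sup_annihilator {I : Ideal A} {N : Type*} [AddCommGroup N] [Module A N]
    [Module.Finite A N] {a : A} (h : ∀ x : N, a • x ∈ I • (⊤ : Submodule A N)) :
    ∃ n, a ^ n ∈ I ⊔ Module.annihilator A N := by
  obtain ⟨p, hp, -, hcoeff, heval⟩ :=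
    LinearMap.exists_monic_and_natDegree_eq_and_coeff_mem_pow_and_aeval_eq_zero A
      (algebraMap A (Module.End A N) a) I (by rintro _ ⟨x, rfl⟩; exact h x)
  rw [Polynomial.aeval_algebraMap_apply] at heval
  refine ⟨p.natDegree, ?_⟩
  have h1 : p.eval a ∈ Module.annihilator A N :=
    Module.mem_annihilator.2 fun x => LinearMap.congr_fun heval x
  rw [Polynomial.eval_eq_sum_range, Finset.sum_range_succ, hp.coeff_natDegree, one_mul] at h1
  have h2 : ∑ i ∈ Finset.range p.natDegree, p.coeff i * a ^ i ∈ I := by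
    refine sum_mem fun i hi => Ideal.mul_mem_right _ _ ?_
    exact Ideal.pow_le_self (Nat.sub_ne_zero_of_lt (Finset.mem_range.1 hi)) (hcoeff i)
  rw [← (I ⊔ Module.annihilator A N).add_mem_iff_right (Ideal.mem_sup_left h2)]
  exact Ideal.mem_sup_right h1

theorem exists_pow_maximalIdeal_le_sup_annihilator [IsLocalRing A] [IsNoetherianRing A]
    {I : Ideal A} {N : Type*} [AddCommGroup N] [Module A N] [Module.Finite A N]
    (hIN : IsFiniteLength A (N ⧸ (I • (⊤ : Submodule A N)))) :
    ∃ t, maximalIdeal A ^ t ≤ I ⊔ Module.annihilator A N := by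
  obtain ⟨t, ht⟩ := exists_pow_smul_mem_pow_smul hIN 1
  refine Ideal.exists_pow_le_of_le_radical_of_fg (fun a ha => ?_) (IsNoetherian.noetherian _)
  obtain ⟨n, hn⟩ := exists_pow_mem_sup_annihilator (I := I) (N := N) (a := a ^ t) fun x => by
    have := ht (a ^ t) (Ideal.pow_mem_pow ha t) x
    rwa [pow_one] at this
  exact ⟨t * n, by rwa [pow_mul]⟩

theorem sup_pow_le (I J : Ideal A) (n : ℕ) : (I ⊔ J) ^ n ≤ J ⊔ I ^ n := by
  induction n with
  | zero => simp
  | succ n ih =>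
    rw [pow_succ, pow_succ]
    refine (Ideal.mul_mono ih le_rfl).trans ?_
    rw [Ideal.sup_mul, Ideal.mul_sup (I ^ n)]
    have h1 : J * (I ⊔ J) ≤ J := Ideal.mul_le_left
    have h2 : I ^ n * J ≤ J := Ideal.mul_le_right
    exact sup_le (h1.trans le_sup_left) (sup_le le_sup_right (h2.trans le_sup_left))

/-- The lengths of `A ⧸ (ann N + I ^ n)` are bounded by a multiple of `n ^ dim N`. -/
theorem exists_length_quotient_annihilator_sup_pow_le [IsLocalRing A] [IsNoetherianRing A]
    {I : Ideal A} {N : Type*} [AddCommGroup N] [Module A N] [Module.Finite A N]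
    (hIN : IsFiniteLength A (N ⧸ (I • (⊤ : Submodule A N)))) {r : ℕ}
    (hr : Module.supportDim A N = r) :
    ∃ C : ℕ, ∀ n, Module.length A (A ⧸ (Module.annihilator A N ⊔ I ^ n)) ≤ (C * n ^ r : ℕ) := by
  rw [Module.supportDim_eq_ringKrullDim_quotient_annihilator] at hr
  obtain ⟨s, hcard, hsm, t, ht⟩ := exists_parameters hr
  obtain ⟨T, hT⟩ := exists_pow_maximalIdeal_le_sup_annihilator hIN
  let J := Module.annihilator A N
  have hfin : Module.length A (A ⧸ (J ⊔ Ideal.span (s : Set A))) ≠ ⊤ := by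
    refine length_ne_top_of_pow_smul_eq_zero t _ fun a ha x => ?_
    obtain ⟨x, rfl⟩ := Submodule.Quotient.mk_surjective _ x
    exact (Submodule.Quotient.mk_eq_zero _).2 (Ideal.mul_mem_right _ _ (ht ha))
  obtain ⟨c, hc⟩ := ENat.ne_top_iff_exists.1 hfin
  refine ⟨T ^ r * c, fun n => ?_⟩
  -- Since 𝔪^T ≤ I + ann N, the power x^{Tn} of a parameter lies in ann N + I^n. The r parameters
  -- then give the bound (Tn)^r times a constant.
  have hle : J ⊔ Ideal.span ((· ^ (T * n)) '' (s : Set A)) ≤ J ⊔ I ^ n := by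
    refine sup_le le_sup_left ?_
    rw [Ideal.span_le]
    rintro _ ⟨x, hx, rfl⟩
    change x ^ (T * n) ∈ _
    rw [pow_mul]
    exact sup_pow_le _ _ _ (Ideal.pow_mem_pow (hT (Ideal.pow_mem_pow (hsm hx) T)) n)
  refine (Module.length_le_of_surjective (Submodule.factor hle)
    (Submodule.factor_surjective hle)).trans
    ((length_quotient_sup_span_image_pow_le J s (T * n)).trans ?_)
  rw [← hc, hcard]
  norm_cast
  rw [mul_pow, mul_right_comm]

/-- If P had degree at least r, then h(n) would eventually be at least a positive multiple of n^r,
and the m terms with m ≤ n < 2m would sum to at least a multiple of m^{r+1}, against the bound C(2m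
+ c)^r ≤ C(3m)^r. -/
theorem polyDeg_le_of_sum_le {h : ℕ → ℕ} {P : Polynomial ℚ} {r B C c : ℕ}
    (hP : ∀ᶠ n : ℕ in Filter.atTop, (h n : ℚ) = P.eval (n : ℚ))
    (hsum : ∀ m, ∑ n ∈ Finset.Ico B m, h n ≤ C * (m + c) ^ r) : polyDeg P ≤ (r : ℤ) - 1 := by
  by_contra! hlt
  have hr : (Polynomial.X ^ r : Polynomial ℚ).degree ≤ P.degree := by
    unfold polyDeg at hlt
    split_ifs at hlt with h0
    · omega
    · rw [Polynomial.degree_X_pow, Polynomial.degree_eq_natDegree h0]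
      exact_mod_cast (by omega : r ≤ P.natDegree)
  obtain ⟨b, hb0, hb⟩ := (Polynomial.isBigO_atTop_of_degree_le _ _ hr).exists_pos
  have hb' := tendsto_natCast_atTop_atTop (R := ℚ) |>.eventually hb.bound
  obtain ⟨n₀, hn₀⟩ := Filter.eventually_atTop.1 (hb'.and hP)
  have hlow : ∀ n, n₀ ≤ n → (n : ℝ) ^ r ≤ b * h n := by
    intro n hn
    obtain ⟨h1, h2⟩ := hn₀ n hn
    rw [← h2, Polynomial.eval_pow, Polynomial.eval_X] at h1
    rw [norm_pow] at h1
    have h3 : ‖(n : ℚ)‖ = n := by rw [← Int.cast_natCast, Int.norm_cast_rat]; simp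
    have h4 : ‖(h n : ℚ)‖ = h n := by rw [← Int.cast_natCast, Int.norm_cast_rat]; simp
    rwa [h3, h4] at h1
  obtain ⟨m, hm⟩ := exists_nat_gt (b * C * 3 ^ r + n₀ + B + c + 1)
  have hpos : 0 ≤ b * C * 3 ^ r := by positivity
  have hmn : n₀ ≤ m := by
    have : (n₀ : ℝ) < m := by linarith [(B.cast_nonneg : (0 : ℝ) ≤ B), (c.cast_nonneg : (0 : ℝ) ≤ c)]
    exact_mod_cast this.le
  have hmB : B ≤ m := by
    have : (B : ℝ) < m := by linarith [(n₀.cast_nonneg : (0 : ℝ) ≤ n₀), (c.cast_nonneg : (0 : ℝ) ≤ c)]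
    exact_mod_cast this.le
  have hmc : (c : ℝ) < m := by
    linarith [(n₀.cast_nonneg : (0 : ℝ) ≤ n₀), (B.cast_nonneg : (0 : ℝ) ≤ B)]
  have hm0 : (0 : ℝ) < m := lt_of_le_of_lt c.cast_nonneg hmc
  have h1 : (m : ℝ) * (m : ℝ) ^ r ≤ b * ∑ n ∈ Finset.Ico m (2 * m), (h n : ℝ) := by
    rw [Finset.mul_sum]
    calc (m : ℝ) * (m : ℝ) ^ r = ∑ n ∈ Finset.Ico m (2 * m), (m : ℝ) ^ r := by
          rw [Finset.sum_const, Nat.card_Ico, show 2 * m - m = m by omega, nsmul_eq_mul]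
      _ ≤ _ := Finset.sum_le_sum fun n hn => by
          have hmn' := (Finset.mem_Ico.1 hn).1
          refine le_trans ?_ (hlow n (hmn.trans hmn'))
          gcongr
  have h2 : (∑ n ∈ Finset.Ico m (2 * m), (h n : ℝ)) ≤ C * (3 * m : ℝ) ^ r := by
    have h3 : ∑ n ∈ Finset.Ico m (2 * m), h n ≤ C * (2 * m + c) ^ r :=
      (Finset.sum_le_sum_of_subset (Finset.Ico_subset_Ico hmB le_rfl)).trans (hsum (2 * m))
    have h4 : (∑ n ∈ Finset.Ico m (2 * m), (h n : ℝ)) ≤ C * (2 * m + c : ℝ) ^ r := by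
      exact_mod_cast h3
    refine h4.trans ?_
    gcongr
    linarith
  have h5 : (m : ℝ) * (m : ℝ) ^ r ≤ (b * C * 3 ^ r) * (m : ℝ) ^ r := by
    refine h1.trans ((mul_le_mul_of_nonneg_left h2 hb0.le).trans (le_of_eq ?_))
    rw [mul_pow]
    ring
  have h6 := le_of_mul_le_mul_right h5 (pow_pos hm0 r)
  linarith [(n₀.cast_nonneg : (0 : ℝ) ≤ n₀), (B.cast_nonneg : (0 : ℝ) ≤ B),
    (c.cast_nonneg : (0 : ℝ) ≤ c)]

/-- The sum telescopes to at most k values of L, none exceeding L(m + k). -/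
theorem sum_range_sub_le {L : ℕ → ℕ} (hL : Monotone L) (k m : ℕ) :
    ∑ j ∈ Finset.range m, (L (j + k) - L j) ≤ k * L (m + k) := by
  have h : ∑ j ∈ Finset.range m, (L (j + k) - L j) ≤ ∑ i ∈ Finset.range k, L (m + i) := by
    induction m with
    | zero => simp
    | succ m ih =>
      have h1 := Finset.sum_range_succ (fun i => L (m + i)) k
      have h2 := Finset.sum_range_succ' (fun i => L (m + i)) k
      have h3 : ∑ i ∈ Finset.range k, L (m + 1 + i) = ∑ i ∈ Finset.range k, L (m + (i + 1)) :=
        Finset.sum_congr rfl fun i _ => by rw [add_assoc, add_comm 1]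
      have h4 := hL (Nat.le_add_right m k)
      rw [Finset.sum_range_succ, h3]
      simp only [add_zero] at h2
      omega
  refine h.trans ?_
  rw [← smul_eq_mul, ← Finset.card_range k, ← Finset.sum_const, Finset.card_range]
  exact Finset.sum_le_sum fun i hi => hL (by have := Finset.mem_range.1 hi; omega)

end

theorem length_range_le_of_ker_le {X Y Z : Type*} [AddCommGroup X] [Module A X]
    [AddCommGroup Y] [Module A Y] [AddCommGroup Z] [Module A Z] {f : X →ₗ[A] Y} {g : X →ₗ[A] Z}
    (h : LinearMap.ker f ≤ LinearMap.ker g) :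
    Module.length A (LinearMap.range g) ≤ Module.length A (LinearMap.range f) := by
  rw [← f.quotKerEquivRange.length_eq, ← g.quotKerEquivRange.length_eq]
  exact Module.length_le_of_surjective (Submodule.factor h) (Submodule.factor_surjective h)

theorem length_le_sum_of_iSup_eq_top {ι : Type*} [Fintype ι] {X : Type*} [AddCommGroup X]
    [Module A X] {S : ι → Submodule A X} (h : ⨆ i, S i = ⊤) :
    Module.length A X ≤ ∑ i, Module.length A (S i) := by
  classical
  let f : (∀ i, S i) →ₗ[A] X := ∑ i, (S i).subtype ∘ₗ LinearMap.proj i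
  rw [← Module.length_pi_of_fintype]
  refine Module.length_le_of_surjective f (LinearMap.range_eq_top.1 (top_le_iff.1 ?_))
  rw [← h]
  refine iSup_le fun i x hx => ⟨Pi.single i ⟨x, hx⟩, ?_⟩
  rw [LinearMap.sum_apply, Finset.sum_eq_single i]
  · simp
  · intro k _ hk
    simp [Pi.single_eq_of_ne hk]
  · simp

/-! ### The degree bound: cyclic pieces of V(M) and the dimension of N. -/

section Degree

variable {I : Ideal A} {N M E : Type u} [AddCommGroup N] [Module A N] [AddCommGroup M] [Module A M]
  [AddCommGroup E] [Module A E] {j : ℕ}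

theorem act_eq_zero_of_mem_annihilator {i m n : ℕ} (h : n = m + i) (a : ↥(I ^ i))
    (ha : (a : A) ∈ Module.annihilator A N) (v : DualPart I N M E j m) :
    act I N M E j h a v = 0 := by
  have : mulQuot I N h a = (0 : A) • mulQuot I N h a := by
    refine Submodule.linearMap_qext _ (LinearMap.ext fun x => ?_)
    simp [mulQuot, Module.mem_annihilator.1 ha]
  ext x
  rw [act, this, extMap_smul, zero_smul]
  simp

theorem pow_smul_dualPart_eq_zero {m k : ℕ} (hk : m < k) {a : A} (ha : a ∈ I ^ k)
    (v : DualPart I N M E j m) : a • v = 0 := by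
  ext e
  rw [LinearMap.smul_apply, ← map_smul, smul_ext_eq_zero (fun x => ?_) e, map_zero,
    LinearMap.zero_apply]
  obtain ⟨x, rfl⟩ := Submodule.Quotient.mk_surjective _ x
  exact (Submodule.Quotient.mk_eq_zero _).2
    (Submodule.smul_mem_smul (Ideal.pow_le_pow_right hk ha) Submodule.mem_top)

/-- I^{m+1} kills N/I^{m+1}N, hence also V(M)_m. An element of I^{i+k} is a sum of products bc with
b ∈ I^i and c ∈ I^k, and for k > m each factor c already kills v. -/
theorem act_eq_zero_of_mem_pow_add {i m n k : ℕ} (h : n = m + i) (hk : m < k) (a : ↥(I ^ i))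
    (ha : (a : A) ∈ I ^ (i + k)) (v : DualPart I N M E j m) : act I N M E j h a v = 0 := by
  suffices ∃ hb : (a : A) ∈ I ^ i, act I N M E j h ⟨a, hb⟩ v = 0 from this.2
  rw [pow_add] at ha
  refine Submodule.mul_induction_on ha (fun b hb c hc => ?_) fun x y hx hy => ?_
  · refine ⟨Ideal.mul_mem_right _ _ hb, ?_⟩
    have : (⟨b * c, Ideal.mul_mem_right _ _ hb⟩ : ↥(I ^ i)) = c • ⟨b, hb⟩ :=
      Subtype.ext (mul_comm b c)
    rw [this, act_smul, LinearMap.smul_apply, ← map_smul, pow_smul_dualPart_eq_zero hk hc, map_zero]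
  · obtain ⟨hx, hx'⟩ := hx
    obtain ⟨hy, hy'⟩ := hy
    refine ⟨add_mem hx hy, ?_⟩
    have := (actAt h v).map_add ⟨x, hx⟩ ⟨y, hy⟩
    rw [actAt_apply, actAt_apply, actAt_apply, hx', hy', add_zero] at this
    exact this

/-- The map a ↦ (a t^i)v factors through (I^i + ann N)/(I^{i+k} + ann N). The bound is stated as a
sum to avoid subtraction of possibly infinite lengths. -/
theorem length_range_actAt_add_le {i m n k : ℕ} (h : n = m + i) (hk : m < k)
    (v : DualPart I N M E j m) :
    Module.length A (LinearMap.range (actAt h v)) +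
        Module.length A (A ⧸ (Module.annihilator A N ⊔ I ^ i)) ≤
      Module.length A (A ⧸ (Module.annihilator A N ⊔ I ^ (i + k))) := by
  have hle : Module.annihilator A N ⊔ I ^ (i + k) ≤ Module.annihilator A N ⊔ I ^ i :=
    sup_le_sup le_rfl (Ideal.pow_le_pow_right (Nat.le_add_right i k))
  let ψ : ↥(I ^ i) →ₗ[A] A ⧸ (Module.annihilator A N ⊔ I ^ (i + k)) :=
    Submodule.mkQ _ ∘ₗ Submodule.subtype _
  have hψ : LinearMap.ker ψ ≤ LinearMap.ker (actAt h v) := by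
    intro a ha
    have ha' : (a : A) ∈ Module.annihilator A N ⊔ I ^ (i + k) :=
      (Submodule.Quotient.mk_eq_zero _).1 ha
    obtain ⟨b, hb, c, hc, hbc⟩ := Submodule.mem_sup.1 ha'
    have hci : c ∈ I ^ i := Ideal.pow_le_pow_right (Nat.le_add_right i k) hc
    have hbi : b ∈ I ^ i := by
      rw [eq_sub_of_add_eq hbc]
      exact sub_mem a.2 hci
    have : a = ⟨b, hbi⟩ + ⟨c, hci⟩ := Subtype.ext hbc.symm
    rw [LinearMap.mem_ker, this, map_add, actAt_apply, actAt_apply,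
      act_eq_zero_of_mem_annihilator h _ hb, act_eq_zero_of_mem_pow_add h hk _ hc, add_zero]
  rw [Module.length_eq_add_of_exact (LinearMap.range ψ).subtype (Submodule.factor hle)
    (Submodule.injective_subtype _) (Submodule.factor_surjective hle) ?_]
  · exact add_le_add (length_range_le_of_ker_le hψ) le_rfl
  · rw [LinearMap.exact_iff, Submodule.range_subtype]
    ext x
    constructor
    · intro hx
      obtain ⟨x, rfl⟩ := Submodule.Quotient.mk_surjective _ x
      have hx' : x ∈ Module.annihilator A N ⊔ I ^ i := (Submodule.Quotient.mk_eq_zero _).1 hx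
      obtain ⟨b, hb, c, hc, rfl⟩ := Submodule.mem_sup.1 hx'
      refine ⟨⟨c, hc⟩, (Submodule.Quotient.eq _).2 ?_⟩
      have : c - (b + c) = -b := by ring
      change c - (b + c) ∈ _
      rw [this]
      exact neg_mem (Submodule.mem_sup_left hb)
    · rintro ⟨a, rfl⟩
      exact (Submodule.Quotient.mk_eq_zero _).2 (Submodule.mem_sup_right a.2)

theorem act_mem_range_actAt {i i' m n : ℕ} (h : n = m + i) (h' : n = m + i') (a : ↥(I ^ i))
    (v : DualPart I N M E j m) : act I N M E j h a v ∈ LinearMap.range (actAt h' v) := by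
  obtain rfl : i = i' := by omega
  exact ⟨a, rfl⟩

/-- The components of finitely many generators are finitely many homogeneous generators, of degree
at most B. Restricting to n ≥ B makes every difference n - e genuine. -/
theorem exists_homogeneous_generators [Module.Finite (reesAlgebra I) (DualSum I N M E j)] :
    ∃ (s B : ℕ) (v : Fin s → ∀ e : Fin (B + 1), DualPart I N M E j e),
      ∀ n (hn : B ≤ n), ⨆ z : Fin s × Fin (B + 1),
        LinearMap.range (actAt (i := n - z.2) (n := n) (by omega) (v z.1 z.2)) = ⊤ := by
  obtain ⟨s, w, hw⟩ := Module.Finite.exists_fin (R := reesAlgebra I) (M := DualSum I N M E j)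
  have hB : ∀ l, ∃ B, ∀ m, B < m → proj I N M E j m (w l) = 0 := by
    intro l
    induction w l using dualSum_induction with
    | zero => exact ⟨0, fun m _ => map_zero _⟩
    | incl n x => exact ⟨n, fun m hm => proj_incl_of_ne hm.ne x⟩
    | add x y hx hy =>
      obtain ⟨B, hB⟩ := hx
      obtain ⟨B', hB'⟩ := hy
      exact ⟨max B B', fun m hm => by
        rw [map_add, hB m (by omega), hB' m (by omega), add_zero]⟩
  choose B hB using hB
  refine ⟨s, Finset.univ.sup B, fun l e => proj I N M E j e (w l), fun n hn => ?_⟩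
  refine top_le_iff.1 fun x _ => ?_
  have hx : incl I N M E j n x ∈ Submodule.span (reesAlgebra I) (Set.range w) :=
    hw ▸ Submodule.mem_top
  obtain ⟨c, hc⟩ := (Submodule.mem_span_range_iff_exists_fun _).1 hx
  rw [← proj_incl_self n x, ← hc, map_sum]
  refine sum_mem fun l _ => ?_
  rw [sum_reesMonomial (c l), Finset.sum_smul, map_sum]
  refine sum_mem fun i _ => ?_
  generalize coeffHom I i (c l) = a
  rcases lt_or_ge n i with h | h
  · rw [proj_smul_of_lt h]
    exact zero_mem _
  · obtain ⟨m, rfl⟩ := Nat.exists_eq_add_of_le' h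
    rw [proj_smul_add]
    by_cases hm : m ≤ Finset.univ.sup B
    · refine Submodule.mem_iSup_of_mem (l, ⟨m, Nat.lt_succ_of_le hm⟩) ?_
      exact act_mem_range_actAt _ _ a _
    · rw [hB l m (lt_of_le_of_lt (Finset.le_sup (Finset.mem_univ l)) (not_le.1 hm)), map_zero]
      exact zero_mem _

/-- The sums of the lengths of the components of `V(M)` grow at most like a polynomial of degree
`dim N`. -/
theorem exists_sum_length_le [IsLocalRing A] [IsNoetherianRing A] [Module.Finite A N]
    [Module.Finite (reesAlgebra I) (DualSum I N M E j)]
    (hIN : IsFiniteLength A (N ⧸ (I • (⊤ : Submodule A N)))) {r : ℕ}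
    (hr : Module.supportDim A N = r) :
    ∃ B C c : ℕ, ∀ m, ∑ n ∈ Finset.Ico B m, (Module.length A (DualPart I N M E j n)).toNat ≤
      C * (m + c) ^ r := by
  obtain ⟨s, B, v, hv⟩ := exists_homogeneous_generators (I := I) (N := N) (M := M) (E := E) (j := j)
  obtain ⟨C, hC⟩ := exists_length_quotient_annihilator_sup_pow_le hIN hr
  have hfin : ∀ n, Module.length A (A ⧸ (Module.annihilator A N ⊔ I ^ n)) ≠ ⊤ := fun n =>
    ne_top_of_le_ne_top (ENat.natCast_ne_top _) (hC n)
  choose L hL using fun n => ENat.ne_top_iff_exists.1 (hfin n)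
  have hLC : ∀ n, L n ≤ C * n ^ r := fun n => by
    have := hC n
    rw [← hL] at this
    exact_mod_cast this
  have hmono : Monotone L := fun m n hmn => by
    have hle : Module.annihilator A N ⊔ I ^ n ≤ Module.annihilator A N ⊔ I ^ m :=
      sup_le_sup le_rfl (Ideal.pow_le_pow_right hmn)
    have := Module.length_le_of_surjective (Submodule.factor hle) (Submodule.factor_surjective hle)
    rw [← hL, ← hL] at this
    exact_mod_cast this
  -- The shift B + 1 exceeds every generator degree, so one k serves all generators at once.
  have hlen : ∀ n, B ≤ n → (Module.length A (DualPart I N M E j n)).toNat ≤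
      ∑ z : Fin s × Fin (B + 1), (L (n - z.2 + (B + 1)) - L (n - z.2)) := by
    intro n hn
    refine ENat.toNat_le_of_le_natCast ((length_le_sum_of_iSup_eq_top (hv n hn)).trans ?_)
    rw [Nat.cast_sum]
    refine Finset.sum_le_sum fun z _ => ?_
    have := length_range_actAt_add_le (i := n - z.2) (n := n) (by omega) z.2.2 (v z.1 z.2)
    rw [← hL, ← hL] at this
    obtain ⟨y, hy⟩ := ENat.ne_top_iff_exists.1
      (ne_top_of_le_ne_top (ENat.natCast_ne_top _) (le_self_add.trans this))
    rw [← hy] at this ⊢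
    norm_cast at this ⊢
    omega
  refine ⟨B, s * (B + 1) * (B + 1) * C, B + 1, fun m => ?_⟩
  calc ∑ n ∈ Finset.Ico B m, (Module.length A (DualPart I N M E j n)).toNat
      ≤ ∑ n ∈ Finset.Ico B m, ∑ z : Fin s × Fin (B + 1),
          (L (n - z.2 + (B + 1)) - L (n - z.2)) :=
        Finset.sum_le_sum fun n hn => hlen n (Finset.mem_Ico.1 hn).1
    _ = ∑ z : Fin s × Fin (B + 1), ∑ n ∈ Finset.Ico B m,
          (L (n - z.2 + (B + 1)) - L (n - z.2)) := Finset.sum_comm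
    _ ≤ ∑ z : Fin s × Fin (B + 1), (B + 1) * (C * (m + (B + 1)) ^ r) := by
        refine Finset.sum_le_sum fun z _ => ?_
        refine le_trans ?_ (Nat.mul_le_mul_left (B + 1) (hLC (m + (B + 1))))
        refine le_trans ?_ (sum_range_sub_le hmono (B + 1) m)
        -- The reindexing n ↦ n - e is injective on n ≥ B ≥ e, and enlarging its image to all
        -- indices below m allows telescoping.
        rw [← Finset.sum_image (f := fun i => L (i + (B + 1)) - L i) (g := fun n => n - (z.2 : ℕ))]
        · refine Finset.sum_le_sum_of_subset fun i hi => ?_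
          obtain ⟨n, hn, rfl⟩ := Finset.mem_image.1 hi
          have := Finset.mem_Ico.1 hn
          exact Finset.mem_range.2 (by omega)
        · intro a ha b hb hab
          have h1 := Finset.mem_Ico.1 ha
          have h2 := Finset.mem_Ico.1 hb
          have := z.2.2
          change a - (z.2 : ℕ) = b - z.2 at hab
          omega
    _ = s * (B + 1) * (B + 1) * C * (m + (B + 1)) ^ r := by
        rw [Finset.sum_const, Finset.card_univ, Fintype.card_prod, Fintype.card_fin,
          Fintype.card_fin, smul_eq_mul]
        ring

end Degree

end ReesExt

end

theorem theorem8p3 {A : Type u} [CommRing A] [IsLocalRing A] [IsNoetherianRing A]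
    [IsAdicComplete (IsLocalRing.maximalIdeal A) A]
    (hCM : ReesExt.IsCohenMacaulayLocal A)
    (hk : Infinite (IsLocalRing.ResidueField A))
    (d : ℕ) (hd : ringKrullDim A = d)
    (E : Type u) [AddCommGroup E] [Module A E] (hE : ReesExt.IsResidueFieldInjectiveHull A E)
    (I : Ideal A) (hI : I ≤ IsLocalRing.maximalIdeal A)
    (N : Type u) [AddCommGroup N] [Module A N] (hN : ReesExt.IsPerfect A N)
    (hIN : IsFiniteLength A (N ⧸ (I • (⊤ : Submodule A N))))
    (r : ℕ) (hr : Module.supportDim A N = r)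
    (M : Type u) [AddCommGroup M] [Module A M] [Module.Finite A M] :
    -- `V(M)` is a graded module over the Rees algebra (it is the direct sum of its components)
    (∀ (i n : ℕ) (a : ↥(I ^ i)) (v : ReesExt.DualPart I N M E (d + 1) n),
      ReesExt.reesMonomial I i a • ReesExt.incl I N M E (d + 1) n v ∈
        LinearMap.range (ReesExt.incl I N M E (d + 1) (n + i))) ∧
    -- it is finitely generated
    Module.Finite (reesAlgebra I) (ReesExt.DualSum I N M E (d + 1)) ∧
    -- the length function of the `Ext` modules, which is also that of `V(M)`
    (∀ n, Module.length A (ReesExt.DualPart I N M E (d + 1) n) =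
      Module.length A (ReesExt.ExtPart I N M (d + 1) n)) ∧
    ReesExt.IsPolynomialTypeOfDegLE
      (fun n => Module.length A (ReesExt.ExtPart I N M (d + 1) n)) ((r : ℤ) - 1) := by
  have := hN.finite
  have := hE.injective
  have hfin := ReesExt.length_extPart_ne_top (M := M) hIN (d + 1)
  have hlen : ∀ n, Module.length A (ReesExt.DualPart I N M E (d + 1) n) =
      Module.length A (ReesExt.ExtPart I N M (d + 1) n) := fun n =>
    ReesExt.length_dual hE (Module.length_ne_top_iff.1 (hfin n))
  obtain ⟨K, _, _, κ, htors, hsocle, hκ⟩ :=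
    ReesExt.exists_torsion_module_hom_ext_surjective hCM hd hN M
  have := ReesExt.finite_dual hE K htors
  have hV : Module.Finite (reesAlgebra I) (ReesExt.DualSum I N M E (d + 1)) :=
    ReesExt.finite_dualSum κ fun n e => by
      obtain ⟨t, ht⟩ := ReesExt.exists_pow_smul_mem_pow_smul hIN (n + 1)
      exact hκ _ t ht e
  refine ⟨fun i n a v => ⟨_, (ReesExt.reesMonomial_smul_incl a v).symm⟩, hV, hlen, hfin, ?_⟩
  simp only [← hlen]
  obtain ⟨P, hP⟩ := ReesExt.exists_polynomial_length (I := I) (N := N) (M := M) (E := E)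
    (j := d + 1) fun n => by rw [hlen]; exact hfin n
  obtain ⟨B, C, c, hsum⟩ := ReesExt.exists_sum_length_le (M := M) (E := E) (j := d + 1) hIN hr
  exact ⟨P, ReesExt.polyDeg_le_of_sum_le hP hsum, hP⟩
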